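/- The models of a DNF with $n\ge 1$ variables and $m$ terms can be enumerated with average delay $O(n\,m^{1-\log_3 2})$ and polynomial space, on a random access machine, after a polynomial-time precomputation. In detail. A term over the variables $x_1,\dots,x_n$ is a finite set of literals with pairwise different variables, a DNF $D$ is a finite set of $m$ terms, and a model of $D$ is an assignment $\{x_1,\dots,x_n\}\to\{0,1\}$ that satisfies all literals of some term of $D$. The input is a word that lists the $m$ terms of $D$ without repetition, in any order (with $n$ in unary, then $n$ letters per term saying how each variable occurs in it); it has length $N=n(m+1)$. The registers $R_0,R_1,\dots$ of the machine hold natural numbers; besides reading and writing registers (directly, or indirectly at an address $R_j+d$ with $d$ a constant), reading letters of the input, jumps and comparisons, it has addition, subtraction (truncated at $0$) and multiplication, and an instruction that outputs the values of a block $R_a,R_{a+1},\dots,R_b$, where $a$ and $b$ are held in registers. An arithmetic instruction takes time linear in the number of bits of its arguments; every other instruction takes constant time. The space used at a step is the total number of bits of the integers in the registers. There are one program for such a machine, a constant $C$ and polynomials $p,q$ such that for every $n\ge 1$, every DNF $D$ with $n$ variables and $m\ge 0$ terms, and every such input word for $D$: the machine halts, having output every model of $D$ (as the word of its $n$ values)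 exactly once and nothing else; it outputs nothing during a precomputation phase of time at most $p(N)$, and the time from the end of this phase until the machine halts is at most $C\cdot n\,m^{1-\log_3 2}$ times the number of models of $D$; and the space used is at most $q(N)$ at every step. -/

import Mathlib

/-! ### Terms, disjunctive normal forms and their models -/

/-- A literal over the variables `x_0, …, x_{n-1}`: a variable together with a sign
(`true` for the variable itself, `false` for its negation). -/
abbrev Literal (n : ℕ) := Fin n × Bool

/-- A term: a finite set of literals, any two of which have different variables. -/
@[ext]
structure Term (n : ℕ) where
  lits : Finset (Literal n)
  consistent : ∀ l ∈ lits, ∀ l' ∈ lits, l.1 = l'.1 → l = l'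

/-- A DNF over `n` variables: a finite set of terms. -/
abbrev DNF (n : ℕ) := Finset (Term n)

/-- The assignment `a` satisfies every literal of the term `T`. -/
def Term.SatisfiedBy {n : ℕ} (T : Term n) (a : Fin n → Bool) : Prop :=
  ∀ l ∈ T.lits, a l.1 = l.2

/-- The assignment `a` is a model of the DNF `D`. -/
def DNF.IsModel {n : ℕ} (D : DNF n) (a : Fin n → Bool) : Prop :=
  ∃ T ∈ D, T.SatisfiedBy a

/-! ### Words encoding formulas and assignments

Input words are over the alphabet `{1, 2, 3, 4}`; the value `0` is the blank. -/

/-- The letter telling how the variable `i` occurs in `T`: negatively (`1`), positively (`2`)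
or not at all (`3`). -/
def Term.letter {n : ℕ} (T : Term n) (i : Fin n) : ℕ :=
  if (i, false) ∈ T.lits then 1 else if (i, true) ∈ T.lits then 2 else 3

/-- The word for a list of terms over `n` variables: `n` in unary (letter `4`), followed by
`n` letters for each term. Its length is `n * (m + 1)` for `m` terms. -/
def encodeTerms {n : ℕ} (L : List (Term n)) : List ℕ :=
  List.replicate n 4 ++ L.flatMap (fun T => List.ofFn T.letter)

/-- The word `a(x_0) a(x_1) … a(x_{n-1})` over `{0, 1}`. -/
def encodeAssignment {n : ℕ} (a : Fin n → Bool) : List ℕ :=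
  List.ofFn (fun i => (a i).toNat)

/-! ### Random access machines with output -/

namespace RAM

/-- Instructions. `R_i` is the `i`-th register; registers hold natural numbers. -/
inductive Instr where
  /-- `R_i := c` -/
  | const (i c : ℕ)
  /-- `R_i := R_j` -/
  | copy (i j : ℕ)
  /-- indirect reading: `R_i := R_a` where `a = R_j + d` -/
  | load (i j d : ℕ)
  /-- indirect writing: `R_a := R_j` where `a = R_i + d` -/
  | store (i d j : ℕ)
  /-- `R_i :=` the letter of the input word at position `R_j`, or `0` past its end -/
  | input (i j : ℕ)
  /-- `R_i := R_j + R_k` -/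
  | add (i j k : ℕ)
  /-- `R_i := R_j - R_k`, or `0` if this is negative -/
  | sub (i j k : ℕ)
  /-- `R_i := R_j * R_k` -/
  | mul (i j k : ℕ)
  /-- continue at the instruction number `t` -/
  | jump (t : ℕ)
  /-- continue at the instruction number `t` if `R_i < R_j` -/
  | jumpLt (i j t : ℕ)
  /-- output the registers `R_a, R_{a+1}, …, R_b` where `a = R_i` and `b = R_j` -/
  | output (i j : ℕ)

/-- A program is a list of instructions, numbered from `0`. -/
abbrev Program := List Instr

/-- A configuration: the number of the next instruction, the registers (all but finitely many
are `0`), the words output so far in order, and the time used so far. -/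
structure Config where
  pc : ℕ
  reg : ℕ →₀ ℕ
  out : List (List ℕ)
  time : ℕ

/-- The start: all registers are `0`. -/
noncomputable def Config.init : Config := ⟨0, 0, [], 0⟩

/-- Write `v` to the register `a`, in time `t`, and go to the next instruction. -/
noncomputable def Config.write (c : Config) (a v t : ℕ) : Config :=
  ⟨c.pc + 1, c.reg.update a v, c.out, c.time + t⟩

/-- The effect and the time of an instruction, on the input word `x`: an arithmetic instruction
takes time linear in the bit lengths of its two arguments, any other takes one time unit. -/
noncomputable def Instr.exec (x : List ℕ) (c : Config) : Instr → Config
  | .const i v => c.write i v 1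
  | .copy i j => c.write i (c.reg j) 1
  | .load i j d => c.write i (c.reg (c.reg j + d)) 1
  | .store i d j => c.write (c.reg i + d) (c.reg j) 1
  | .input i j => c.write i (x.getD (c.reg j) 0) 1
  | .add i j k => c.write i (c.reg j + c.reg k) (1 + (c.reg j).size + (c.reg k).size)
  | .sub i j k => c.write i (c.reg j - c.reg k) (1 + (c.reg j).size + (c.reg k).size)
  | .mul i j k => c.write i (c.reg j * c.reg k) (1 + (c.reg j).size + (c.reg k).size)
  | .jump t => ⟨t, c.reg, c.out, c.time + 1⟩
  | .jumpLt i j t => ⟨if c.reg i < c.reg j then t else c.pc + 1, c.reg, c.out, c.time + 1⟩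
  | .output i j =>
      ⟨c.pc + 1, c.reg,
        c.out ++ [(List.range' (c.reg i) (c.reg j + 1 - c.reg i)).map c.reg], c.time + 1⟩

/-- One step of the program `P` on the input word `x`; a halted configuration stays as it is. -/
noncomputable def step (P : Program) (x : List ℕ) (c : Config) : Config :=
  match P[c.pc]? with
  | some I => I.exec x c
  | none => c

/-- The configuration of `P` on the input word `x` after `k` steps. -/
noncomputable def run (P : Program) (x : List ℕ) (k : ℕ) : Config :=
  (step P x)^[k] Config.init

/-- The machine has halted: there is no instruction at the current position. -/
def Config.Halted (P : Program) (c : Config) : Prop := P.length ≤ c.pc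

/-- The space of a configuration: the total number of bits of the integers in the registers. -/
noncomputable def Config.space (c : Config) : ℕ := c.reg.sum (fun _ v => v.size)

/-- On the input word `x`, the program `P` halts, having output every word of `A` exactly once
and no other word. -/
def Enumerates (P : Program) (x : List ℕ) (A : Set (List ℕ)) : Prop :=
  ∃ k, (run P x k).Halted P ∧ (run P x k).out.Nodup ∧ ∀ y, y ∈ (run P x k).out ↔ y ∈ A

/-- On the input word `x`, the program `P` has average delay at most `d` after a precomputation
phase of time at most `t`: nothing is output in the precomputation phase, which ends after `k₀`
steps, and the time from there until the machine halts is at most `d` times the number of words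
that are output. -/
def HasAverageDelay (P : Program) (x : List ℕ) (t : ℕ) (d : ℝ) : Prop :=
  ∃ k₀ k, k₀ ≤ k ∧ (run P x k₀).out = [] ∧ (run P x k₀).time ≤ t ∧ (run P x k).Halted P ∧
    ((run P x k).time : ℝ) - (run P x k₀).time ≤ d * (run P x k).out.length

/-- On the input word `x`, the program `P` uses space at most `t` at every step. -/
def UsesSpace (P : Program) (x : List ℕ) (t : ℕ) : Prop :=
  ∀ k, (run P x k).space ≤ t

end RAM

/-!
The models are found by a search in the binary tree of partial assignments, which fixes the
variables in descending order and cuts off the branches without models. The time for a node of this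
tree is proportional to the number `k` of *different* terms that are left after the partial
assignment. Such a DNF with `s` models has `k ≤ s ^ log_2 3` terms
(`length_le_rpow_length_enum`): by induction on the number of variables this comes down to
`a ^ t + 2 * b ^ t ≤ (a + b) ^ t` for `0 ≤ b ≤ a` and `t = log_2 3`, which is convexity
(`rpow_add_two_mul_rpow_le`). Hence `k = k ^ (1 - log_3 2) * k ^ log_3 2 ≤ m ^ (1 - log_3 2) * s`,
and as every model lies below one node of each level, the nodes of a level take time
`O(m ^ (1 - log_3 2))` per model, and the `n + 1` levels together `O(n * m ^ (1 - log_3 2))` per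
model (`cost_le`).

What remains of a term after the variables `x_j, …, x_{n-1}` are fixed is its part on
`x_0, …, x_{j-1}`. The precomputation builds a record, called a state, for each of these prefixes,
with pointers to the states that result from giving the last variable the value `false` or `true`.
Equal prefixes are identified: their pointers are equal, so a linear search finds the first record
with the same pointers (`reach_find`). Words of letters are written with the last variable first, so
the restriction of a word is its tail.

A node of the search tree at level `j` is a linked list of different states of length `j`. The link
of a state is stored in the state itself: only one list of each level is in use at a time, so a state
is in at most one list, and a zero link tells that it is in none. So the list for a child is
computed by following one pointer for each state and adding the result unless it is linked already
(`reach_scan`), and it is cleared again afterwards (`reach_clear`). Levels are linked as well, so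
the search follows pointers only and all its instructions take one unit of time.

The functions `enum` and `cost` describe the output and the time of the search on lists of words;
`searches` shows that the program follows them. Executions of the program are described by `Reach`,
which counts instructions, in units of time that may differ for the two phases of the run, and which
also bounds the numbers in all registers at all steps, and with them the space.
-/

namespace DNFEnum

open RAM

/-! ### Words, their restrictions and the enumeration of their models -/

/-- A letter `ℓ` of a term (`1` negative, `2` positive, `3` absent) is compatible with giving
its variable the value `b`. -/
def allows (ℓ : ℕ) : Bool → Bool
  | false => ℓ != 2
  | true => ℓ != 1

/-- Restrict a single word to the value `b` of its first variable, and add the result to the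
duplicate-free list `acc` if the word is compatible with `b`. -/
def push (b : Bool) (acc : List (List ℕ)) : List ℕ → List (List ℕ)
  | [] => acc
  | ℓ :: u => if allows ℓ b = true ∧ u ∉ acc then u :: acc else acc

/-- The list, without repetitions, of the restrictions of the words of `A` to the value `b` of
the first variable. -/
def restrict (b : Bool) (A : List (List ℕ)) : List (List ℕ) :=
  A.foldl (push b) []

/-- The models of the DNF with the words `A` over `j` variables, in lexicographic order. The
list `A` is supposed to be nonempty: over no variables the empty assignment is a model. -/
def enum : ℕ → List (List ℕ) → List (List Bool)
  | 0, _ => [[]]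
  | j + 1, A =>
    (if restrict false A = [] then [] else (enum j (restrict false A)).map (false :: ·)) ++
    (if restrict true A = [] then [] else (enum j (restrict true A)).map (true :: ·))

/-- A bound for the number of instructions in the search for the models of `A` over `j` variables:
at each level a constant number for every word of the list (scanned once for each value, where the
new lists are cleared again), and `4` for an output. -/
def cost : ℕ → List (List ℕ) → ℕ
  | 0, _ => 4
  | j + 1, A => 100 * A.length +
    (if restrict false A = [] then 0 else cost j (restrict false A)) +
    (if restrict true A = [] then 0 else cost j (restrict true A))

theorem mem_push {b : Bool} {acc : List (List ℕ)} {w u : List ℕ} :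
    u ∈ push b acc w ↔ u ∈ acc ∨ ∃ ℓ, w = ℓ :: u ∧ allows ℓ b = true := by
  cases w with
  | nil => simp [push]
  | cons ℓ v =>
    simp only [push]
    split_ifs with h
    · simp only [List.mem_cons, List.cons.injEq]
      constructor
      · rintro (rfl | h')
        · exact Or.inr ⟨ℓ, ⟨rfl, rfl⟩, h.1⟩
        · exact Or.inl h'
      · rintro (h' | ⟨_, ⟨_, rfl⟩, _⟩)
        · exact Or.inr h'
        · exact Or.inl rfl
    · constructor
      · exact Or.inl
      · rintro (h' | ⟨ℓ', h1, h2⟩)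
        · exact h'
        · simp only [List.cons.injEq] at h1
          obtain ⟨rfl, rfl⟩ := h1
          by_contra hu
          exact h ⟨h2, hu⟩

theorem nodup_push {b : Bool} {acc : List (List ℕ)} {w : List ℕ} (h : acc.Nodup) :
    (push b acc w).Nodup := by
  cases w with
  | nil => exact h
  | cons ℓ v =>
    simp only [push]
    split_ifs with h'
    · exact List.nodup_cons.2 ⟨h'.2, h⟩
    · exact h

theorem length_push_le {b : Bool} {acc : List (List ℕ)} {w : List ℕ} :
    (push b acc w).length ≤ acc.length + 1 := by
  cases w with
  | nil => simp [push]
  | cons ℓ v =>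
    simp only [push]
    split_ifs <;> simp

theorem mem_foldl_push {b : Bool} {u : List ℕ} (A acc : List (List ℕ)) :
    u ∈ A.foldl (push b) acc ↔ u ∈ acc ∨ ∃ ℓ, ℓ :: u ∈ A ∧ allows ℓ b = true := by
  induction A generalizing acc with
  | nil => simp
  | cons w A ih =>
    rw [List.foldl_cons, ih, mem_push]
    simp only [List.mem_cons, or_assoc]
    refine or_congr_right ?_
    constructor
    · rintro (⟨ℓ, h, h'⟩ | ⟨ℓ, h, h'⟩)
      · exact ⟨ℓ, Or.inl h.symm, h'⟩
      · exact ⟨ℓ, Or.inr h, h'⟩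
    · rintro ⟨ℓ, h | h, h'⟩
      · exact Or.inl ⟨ℓ, h.symm, h'⟩
      · exact Or.inr ⟨ℓ, h, h'⟩

theorem mem_restrict {b : Bool} {u : List ℕ} {A : List (List ℕ)} :
    u ∈ restrict b A ↔ ∃ ℓ, ℓ :: u ∈ A ∧ allows ℓ b = true := by
  simp [restrict, mem_foldl_push]

theorem nodup_foldl_push {b : Bool} (A acc : List (List ℕ)) (h : acc.Nodup) :
    (A.foldl (push b) acc).Nodup := by
  induction A generalizing acc with
  | nil => exact h
  | cons w A ih => exact ih _ (nodup_push h)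

theorem nodup_restrict (b : Bool) (A : List (List ℕ)) : (restrict b A).Nodup :=
  nodup_foldl_push A [] List.nodup_nil

theorem length_foldl_push_le {b : Bool} (A acc : List (List ℕ)) :
    (A.foldl (push b) acc).length ≤ acc.length + A.length := by
  induction A generalizing acc with
  | nil => simp
  | cons w A ih =>
    have h1 := ih (push b acc w)
    have h2 := @length_push_le b acc w
    simp only [List.foldl_cons, List.length_cons]
    omega

theorem length_restrict_le (b : Bool) (A : List (List ℕ)) :
    (restrict b A).length ≤ A.length := by
  simpa [restrict] using length_foldl_push_le (b := b) A []

/-- The words of `A` have `j` letters, each of them `1`, `2` or `3`. -/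
def IsWords (j : ℕ) (A : List (List ℕ)) : Prop :=
  ∀ w ∈ A, w.length = j ∧ ∀ ℓ ∈ w, 1 ≤ ℓ ∧ ℓ ≤ 3

theorem IsWords.restrict {j : ℕ} {A : List (List ℕ)} (h : IsWords (j + 1) A) (b : Bool) :
    IsWords j (restrict b A) := by
  intro u hu
  obtain ⟨ℓ, hℓ, -⟩ := mem_restrict.1 hu
  obtain ⟨h1, h2⟩ := h _ hℓ
  exact ⟨by simpa using h1, fun k hk => h2 k (List.mem_cons_of_mem _ hk)⟩

theorem mem_enum {j : ℕ} {A : List (List ℕ)} (hA : A ≠ []) (h : IsWords j A) {v : List Bool} :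
    v ∈ enum j A ↔ ∃ w ∈ A, List.Forall₂ (fun ℓ b => allows ℓ b = true) w v := by
  induction j generalizing A v with
  | zero =>
    have hw : ∀ w ∈ A, w = [] := fun w hw => List.length_eq_zero_iff.1 (h w hw).1
    obtain ⟨w, hwA⟩ := List.exists_mem_of_ne_nil A hA
    simp only [enum, List.mem_singleton]
    constructor
    · rintro rfl
      exact ⟨w, hwA, by rw [hw w hwA]; exact .nil⟩
    · rintro ⟨w', h1, h2⟩
      rw [hw w' h1] at h2
      simpa using h2
  | succ j ih =>
    -- the models with first value `b`
    have key : ∀ b, (v ∈ (if DNFEnum.restrict b A = [] then [] else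
        (enum j (DNFEnum.restrict b A)).map (b :: ·))) ↔
        ∃ v', v = b :: v' ∧ ∃ w ∈ A, List.Forall₂ (fun ℓ b => allows ℓ b = true) w v := by
      intro b
      constructor
      · intro hv
        split_ifs at hv with hb
        · simp at hv
        · obtain ⟨v', hv', rfl⟩ := List.mem_map.1 hv
          obtain ⟨u, hu, hs⟩ := (ih hb (h.restrict b)).1 hv'
          obtain ⟨ℓ, h1, h2⟩ := mem_restrict.1 hu
          exact ⟨v', rfl, _, h1, .cons h2 hs⟩
      · rintro ⟨v', rfl, w, hw, hs⟩
        cases hs with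
        | cons h1 h2 =>
          have hu := mem_restrict.2 ⟨_, hw, h1⟩
          have hne := List.ne_nil_of_mem hu
          rw [if_neg hne]
          exact List.mem_map.2 ⟨v', (ih hne (h.restrict b)).2 ⟨_, hu, h2⟩, rfl⟩
    rw [enum, List.mem_append, key, key]
    constructor
    · rintro (⟨_, _, h⟩ | ⟨_, _, h⟩) <;> exact h
    · rintro ⟨w, hw, hs⟩
      have hl := (h w hw).1
      cases hs with
      | nil => simp at hl
      | @cons ℓ b w v' h1 h2 =>
        cases b
        · exact Or.inl ⟨v', rfl, _, hw, .cons h1 h2⟩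
        · exact Or.inr ⟨v', rfl, _, hw, .cons h1 h2⟩

theorem nodup_enum (j : ℕ) (A : List (List ℕ)) : (enum j A).Nodup := by
  induction j generalizing A with
  | zero => simp [enum]
  | succ j ih =>
    have key : ∀ b, (if restrict b A = [] then [] else
        (enum j (restrict b A)).map (b :: ·)).Nodup := by
      intro b
      split_ifs
      · exact List.nodup_nil
      · exact (ih _).map (fun x y h => (List.cons.inj h).2)
    rw [enum]
    refine List.nodup_append.2 ⟨key _, key _, ?_⟩
    intro x hx y hy
    split_ifs at hx hy
    all_goals simp only [List.not_mem_nil, List.mem_map] at hx hy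
    obtain ⟨_, _, rfl⟩ := hx
    obtain ⟨_, _, rfl⟩ := hy
    simp

theorem length_eq_of_mem_enum {j : ℕ} {A : List (List ℕ)} {v : List Bool} (hv : v ∈ enum j A) :
    v.length = j := by
  induction j generalizing A v with
  | zero => simp_all [enum]
  | succ j ih =>
    rw [enum, List.mem_append] at hv
    rcases hv with hv | hv <;> split_ifs at hv
    all_goals simp only [List.not_mem_nil, List.mem_map] at hv
    all_goals
      obtain ⟨v', h, rfl⟩ := hv
      simp [ih h]

/-! ### A DNF with few models has few terms -/

theorem one_le_logb_two_three : 1 ≤ Real.logb 2 3 := by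
  rw [Real.le_logb_iff_rpow_le (by norm_num) (by norm_num)]
  norm_num

theorem rpow_logb_two_three : (2 : ℝ) ^ Real.logb 2 3 = 3 :=
  Real.rpow_logb (by norm_num) (by norm_num) (by norm_num)

/-- By convexity, the increment of the power function over an interval of length `b` is least at
the left end. -/
theorem rpow_add_two_mul_rpow_le {a b : ℝ} (hb : 0 ≤ b) (hab : b ≤ a) :
    a ^ Real.logb 2 3 + 2 * b ^ Real.logb 2 3 ≤ (a + b) ^ Real.logb 2 3 := by
  set t := Real.logb 2 3
  have ht : 1 ≤ t := one_le_logb_two_three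
  rcases hb.eq_or_lt with rfl | hb
  · simp [Real.zero_rpow (by linarith : t ≠ 0)]
  have ha : 0 < a := hb.trans_le hab
  have hc := convexOn_rpow ht
  have p1 : 0 ≤ (a - b) / a := div_nonneg (by linarith) ha.le
  have p2 : 0 ≤ b / a := by positivity
  have hab0 : a + b ∈ Set.Ici (0 : ℝ) := by simp only [Set.mem_Ici]; linarith
  have h1 := hc.2 (Set.mem_Ici.2 hb.le) hab0 p1 p2 (by field_simp; ring)
  have h2 := hc.2 (Set.mem_Ici.2 hb.le) hab0 p2 p1 (by field_simp; ring)
  simp only at h1 h2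
  have e1 : ((a - b) / a) • b + (b / a) • (a + b) = 2 * b := by
    simp only [smul_eq_mul]; field_simp; ring
  have e2 : (b / a) • b + ((a - b) / a) • (a + b) = a := by
    simp only [smul_eq_mul]; field_simp; ring
  have e3 : (2 * b) ^ t = 3 * b ^ t := by
    rw [Real.mul_rpow (by norm_num) hb.le, rpow_logb_two_three]
  rw [e1, e3] at h1
  rw [e2] at h2
  have e4 : ((a - b) / a) • b ^ t + (b / a) • (a + b) ^ t +
      ((b / a) • b ^ t + ((a - b) / a) • (a + b) ^ t) = b ^ t + (a + b) ^ t := by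
    simp only [smul_eq_mul]; field_simp; ring
  linarith

/-- Each word over `j + 1` variables is determined by its first letter and the rest, and the
words with an absent first variable contribute to both restrictions. -/
theorem length_le_restrict {j : ℕ} {A : List (List ℕ)} (h : IsWords (j + 1) A)
    (hA : A.Nodup) :
    A.length ≤ (restrict false A).length + (restrict true A).length +
      min (restrict false A).length (restrict true A).length := by
  classical
  have key : ∀ ℓ b, allows ℓ b = true →
      (A.filter (fun w => w.head? = some ℓ)).length ≤ (restrict b A).length := by
    intro ℓ b hb
    have hn : ((A.filter (fun w => w.head? = some ℓ)).map List.tail).Nodup := by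
      refine (hA.filter _).map_on ?_
      intro x hx y hy hxy
      simp only [List.mem_filter, decide_eq_true_eq] at hx hy
      rw [← List.cons_head?_tail hx.2, ← List.cons_head?_tail hy.2, hxy]
    have hs : (A.filter (fun w => w.head? = some ℓ)).map List.tail ⊆ restrict b A := by
      intro u hu
      obtain ⟨w, hw, rfl⟩ := List.mem_map.1 hu
      simp only [List.mem_filter, decide_eq_true_eq] at hw
      refine mem_restrict.2 ⟨ℓ, ?_, hb⟩
      rw [List.cons_head?_tail hw.2]
      exact hw.1
    simpa using (hn.subperm hs).length_le
  have hsum : A.length ≤ (A.filter (fun w => w.head? = some 1)).length +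
      (A.filter (fun w => w.head? = some 2)).length +
      (A.filter (fun w => w.head? = some 3)).length := by
    clear hA key
    induction A with
    | nil => simp
    | cons w A ih =>
      have ih := ih (fun w hw => h w (List.mem_cons_of_mem _ hw))
      have hw := h w (List.mem_cons_self ..)
      cases w with
      | nil => simp at hw
      | cons ℓ u =>
        have hℓ := hw.2 ℓ (List.mem_cons_self ..)
        have : ℓ = 1 ∨ ℓ = 2 ∨ ℓ = 3 := by omega
        rcases this with rfl | rfl | rfl <;> simp at ih ⊢ <;> omega
  have h1 := key 1 false rfl
  have h2 := key 2 true rfl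
  have h3 := key 3 false rfl
  have h4 := key 3 true rfl
  have h5 := le_min h3 h4
  omega

/-- A DNF with `s` models has at most `s ^ log_2 3` different terms. With `a` and `b` models that give
the first variable the one value and the other, `b ≤ a`, there are at most `a ^ t + 2 * b ^ t`
terms by induction, where `t = log_2 3`. -/
theorem length_le_rpow_length_enum {j : ℕ} {A : List (List ℕ)} (h : IsWords j A)
    (hA : A.Nodup) (hne : A ≠ []) :
    (A.length : ℝ) ≤ ((enum j A).length : ℝ) ^ Real.logb 2 3 := by
  induction j generalizing A with
  | zero =>
    have : A ⊆ [[]] := fun w hw => by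
      simp [List.length_eq_zero_iff.1 (h w hw).1]
    have h1 := (hA.subperm this).length_le
    simp only [List.length_singleton] at h1
    simp only [enum, List.length_singleton, Nat.cast_one, Real.one_rpow]
    exact_mod_cast h1
  | succ j ih =>
    have key : ∀ b, ((restrict b A).length : ℝ) ≤ (((if restrict b A = [] then [] else
        (enum j (restrict b A)).map (b :: ·)).length : ℕ) : ℝ) ^ Real.logb 2 3 := by
      intro b
      split_ifs with hb
      · rw [hb]
        simpa using Real.rpow_nonneg le_rfl _
      · simpa using ih (h.restrict b) (nodup_restrict b A) hb
    have h0 := key false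
    have h1 := key true
    rw [enum, List.length_append]
    set s0 := (if restrict false A = [] then [] else
        (enum j (restrict false A)).map (false :: ·)).length
    set s1 := (if restrict true A = [] then [] else
        (enum j (restrict true A)).map (true :: ·)).length
    have hl : (A.length : ℝ) ≤ (restrict false A).length + (restrict true A).length +
      min ((restrict false A).length : ℝ) (restrict true A).length := by
      exact_mod_cast length_le_restrict h hA
    push_cast
    rcases le_total s0 s1 with hs | hs
    · have := rpow_add_two_mul_rpow_le (a := s1) (b := s0) (by positivity) (by exact_mod_cast hs)
      have h3 := min_le_left ((restrict false A).length : ℝ) (restrict true A).length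
      rw [add_comm (s0 : ℝ)]
      linarith
    · have := rpow_add_two_mul_rpow_le (a := s0) (b := s1) (by positivity) (by exact_mod_cast hs)
      have h3 := min_le_right ((restrict false A).length : ℝ) (restrict true A).length
      linarith

theorem logb_three_two_pos : 0 < Real.logb 3 2 := Real.logb_pos (by norm_num) (by norm_num)

theorem logb_three_two_lt_one : Real.logb 3 2 < 1 := by
  rw [Real.logb_lt_iff_lt_rpow (by norm_num) (by norm_num)]
  norm_num

/-- Raising the previous bound to the power `log_3 2 = 1 / log_2 3` shows that reading the terms
takes time at most `M ^ (1 - log_3 2)` per model. -/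
theorem length_le_rpow_mul_length_enum {j : ℕ} {A : List (List ℕ)} (h : IsWords j A)
    (hA : A.Nodup) (hne : A ≠ []) {M : ℝ} (hM : (A.length : ℝ) ≤ M) :
    (A.length : ℝ) ≤ M ^ (1 - Real.logb 3 2) * (enum j A).length := by
  have h1 := length_le_rpow_length_enum h hA hne
  have hpos : (0 : ℝ) < A.length := by exact_mod_cast List.length_pos_iff.2 hne
  have h2 : (A.length : ℝ) ^ Real.logb 3 2 ≤ (enum j A).length := by
    refine (Real.rpow_le_rpow hpos.le h1 logb_three_two_pos.le).trans_eq ?_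
    rw [← Real.rpow_mul (by positivity), Real.logb, Real.logb]
    have : Real.log 2 ≠ 0 := (Real.log_pos (by norm_num)).ne'
    have : Real.log 3 ≠ 0 := (Real.log_pos (by norm_num)).ne'
    rw [show Real.log 3 / Real.log 2 * (Real.log 2 / Real.log 3) = 1 by field_simp,
      Real.rpow_one]
  calc (A.length : ℝ) = A.length ^ (1 - Real.logb 3 2) * A.length ^ Real.logb 3 2 := by
        rw [← Real.rpow_add hpos]; simp
    _ ≤ M ^ (1 - Real.logb 3 2) * (enum j A).length := by
        have := logb_three_two_lt_one
        exact mul_le_mul (Real.rpow_le_rpow hpos.le hM (by linarith)) h2 (by positivity)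
          (Real.rpow_nonneg (hpos.le.trans hM) _)

/-- At each level of the search tree the work is at most `m ^ (1 - log_3 2)` per model. -/
theorem cost_le {j : ℕ} {A : List (List ℕ)} (h : IsWords j A)
    (hA : A.Nodup) (hne : A ≠ []) {M : ℝ} (hM : (A.length : ℝ) ≤ M) :
    (cost j A : ℝ) ≤ 100 * (j + 1) * M ^ (1 - Real.logb 3 2) * (enum j A).length := by
  have hM0 : 0 ≤ M := le_trans (by positivity) hM
  have hw := length_le_rpow_mul_length_enum h hA hne hM
  have hw1 : (1 : ℝ) ≤ A.length := by exact_mod_cast List.length_pos_iff.2 hne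
  induction j generalizing A with
  | zero =>
    simp only [cost]
    push_cast
    nlinarith
  | succ j ih =>
    have key : ∀ b, (((if restrict b A = [] then 0 else cost j (restrict b A)) : ℕ) : ℝ) ≤
        100 * (j + 1) * M ^ (1 - Real.logb 3 2) * (((if restrict b A = [] then [] else
        (enum j (restrict b A)).map (b :: ·)).length : ℕ) : ℝ) := by
      intro b
      split_ifs with hb
      · simp
      · have hb' : ((restrict b A).length : ℝ) ≤ M :=
          le_trans (by exact_mod_cast length_restrict_le b A) hM
        simpa using ih (h.restrict b) (nodup_restrict b A) hb hb'
          (length_le_rpow_mul_length_enum (h.restrict b) (nodup_restrict b A) hb hb')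
          (by exact_mod_cast List.length_pos_iff.2 hb)
    have h0 := key false
    have h1 := key true
    rw [enum, List.length_append] at hw ⊢
    rw [cost]
    simp only [Nat.cast_add, Nat.cast_mul, Nat.cast_ofNat, Nat.cast_one] at hw ⊢
    linarith

/-! ### Symbolic execution of random access machines -/

section

/-- The memory with the values `r` in the registers below `32`, which are addressed directly, and
the values `h` in the other ones (the heap), which are addressed indirectly. -/
def mem (r h : ℕ → ℕ) : ℕ → ℕ := fun a => if a < 32 then r a else h a

theorem mem_lt {r h : ℕ → ℕ} {a : ℕ} (ha : a < 32) : mem r h a = r a := if_pos ha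

theorem mem_ge {r h : ℕ → ℕ} {a : ℕ} (ha : 32 ≤ a) : mem r h a = h a := if_neg (by omega)

theorem update_mem_lt {r h : ℕ → ℕ} {a v : ℕ} (ha : a < 32) :
    Function.update (mem r h) a v = mem (Function.update r a v) h := by
  funext b
  by_cases hb : b = a
  · subst hb; simp [mem, ha]
  · simp [mem, hb]

theorem update_mem_ge {r h : ℕ → ℕ} {a v : ℕ} (ha : 32 ≤ a) :
    Function.update (mem r h) a v = mem r (Function.update h a v) := by
  funext b
  by_cases hb : b = a
  · subst hb; simp [mem, ha]
  · simp [mem, hb]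

/-- A configuration without its time, with the registers split in two parts as in `mem`. -/
structure St where
  pc : ℕ
  r : ℕ → ℕ
  h : ℕ → ℕ
  out : List (List ℕ)

/-- The configuration `c` is in the state `s`. -/
def St.Matches (s : St) (c : Config) : Prop :=
  c.pc = s.pc ∧ ⇑c.reg = mem s.r s.h ∧ c.out = s.out

/-- An input word `x`, a bound `V` for the numbers in the registers, and a bound `κ` for the time
of an instruction. -/
structure Env where
  x : List ℕ
  V : ℕ
  κ : ℕ
  x_le : ∀ i, x.getD i 0 ≤ V
  V_ge : 40 ≤ V
  κ_pos : 1 ≤ κ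

/-- All numbers are at most `V`, and only registers with numbers below `V + 40` are in use. -/
def Good (V : ℕ) (m : ℕ → ℕ) : Prop := ∀ a, m a ≤ V ∧ (V + 40 ≤ a → m a = 0)

theorem Good.update {V : ℕ} {m : ℕ → ℕ} (hm : Good V m) {a v : ℕ} (ha : a < V + 40)
    (hv : v ≤ V) : Good V (Function.update m a v) := by
  intro b
  by_cases hb : b = a
  · subst hb
    simp only [Function.update_self]
    exact ⟨hv, fun h => by omega⟩
  · simp only [Function.update_of_ne hb]
    exact hm b

theorem Good.space_le {V : ℕ} {c : Config} (hc : Good V c.reg) :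
    c.space ≤ (V + 40) * V := by
  unfold Config.space Finsupp.sum
  have hs : c.reg.support ⊆ Finset.range (V + 40) := by
    intro a ha
    rw [Finset.mem_range]
    by_contra h
    exact Finsupp.mem_support_iff.1 ha ((hc a).2 (by omega))
  calc ∑ a ∈ c.reg.support, (c.reg a).size ≤ ∑ _a ∈ c.reg.support, V := by
        refine Finset.sum_le_sum fun a _ => ?_
        exact (Nat.size_le.2 Nat.lt_two_pow_self).trans (hc a).1
    _ = c.reg.support.card * V := by simp
    _ ≤ (V + 40) * V := by
        gcongr
        simpa using Finset.card_le_card hs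

/-- From the state `s` the program `P` gets to the state `s'` in at most `t` units of time, where
a unit is `κ`, and on the way the bounds in `Good` are kept. -/
def Reach (P : Program) (E : Env) (s : St) (t : ℕ) (s' : St) : Prop :=
  ∀ c : Config, s.Matches c → Good E.V c.reg →
    ∃ k, s'.Matches ((step P E.x)^[k] c) ∧ ((step P E.x)^[k] c).time ≤ c.time + t * E.κ ∧
      ∀ i ≤ k, Good E.V ((step P E.x)^[i] c).reg

variable {P : Program} {E : Env}

theorem Reach.refl {s : St} {t : ℕ} : Reach P E s t s := by
  intro c hc hg
  refine ⟨0, hc, by simp, fun i hi => ?_⟩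
  obtain rfl : i = 0 := by omega
  exact hg

theorem Reach.trans {s s' s'' : St} {t t' : ℕ} (h : Reach P E s t s')
    (h' : Reach P E s' t' s'') : Reach P E s (t + t') s'' := by
  intro c hc hg
  obtain ⟨k, h1, h2, h3⟩ := h c hc hg
  obtain ⟨k', h1', h2', h3'⟩ := h' _ h1 (h3 k le_rfl)
  refine ⟨k' + k, ?_, ?_, ?_⟩
  · rw [Function.iterate_add_apply]; exact h1'
  · rw [Function.iterate_add_apply, add_mul]; omega
  · intro i hi
    rcases le_total i k with hik | hik
    · exact h3 i hik
    · obtain ⟨j, rfl⟩ := Nat.exists_eq_add_of_le' hik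
      rw [Function.iterate_add_apply]
      exact h3' j (by omega)

theorem Reach.mono {s s' : St} {t t' : ℕ} (h : Reach P E s t s') (ht : t ≤ t') :
    Reach P E s t' s' := by
  intro c hc hg
  obtain ⟨k, h1, h2, h3⟩ := h c hc hg
  exact ⟨k, h1, h2.trans (by gcongr), h3⟩

theorem Reach.step {s s' s'' : St} {t : ℕ} {I : Instr} (hP : P[s.pc]? = some I)
    (hI : ∀ c, s.Matches c → Good E.V c.reg → s'.Matches (I.exec E.x c) ∧
      (I.exec E.x c).time ≤ c.time + E.κ ∧ Good E.V (I.exec E.x c).reg)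
    (h : Reach P E s' t s'') : Reach P E s (t + 1) s'' := by
  intro c hc hg
  have hs : RAM.step P E.x c = I.exec E.x c := by
    unfold RAM.step
    rw [hc.1, hP]
  obtain ⟨h1, h2, h3⟩ := hI c hc hg
  obtain ⟨k, h1', h2', h3'⟩ := h _ h1 h3
  refine ⟨k + 1, ?_, ?_, ?_⟩
  · rw [Function.iterate_succ_apply, hs]; exact h1'
  · rw [Function.iterate_succ_apply, hs, add_mul]; omega
  · intro i hi
    cases i with
    | zero => exact hg
    | succ i => rw [Function.iterate_succ_apply, hs]; exact h3' i (by omega)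

variable {pc t : ℕ} {r h : ℕ → ℕ} {out : List (List ℕ)} {s' : St}

/-- An instruction that writes the register `i`. -/
theorem Reach.write {I : Instr} (hP : P[pc]? = some I) {i v : ℕ} (hi : i < 32)
    (hI : ∀ c : Config, ⇑c.reg = mem r h → Good E.V c.reg →
      v ≤ E.V ∧ ∃ u ≤ E.κ, I.exec E.x c = c.write i v u)
    (next : Reach P E ⟨pc + 1, Function.update r i v, h, out⟩ t s') :
    Reach P E ⟨pc, r, h, out⟩ (t + 1) s' := by
  refine Reach.step hP ?_ next
  rintro c ⟨h1, h2, h3⟩ hg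
  obtain ⟨hv, u, hu, he⟩ := hI c h2 hg
  rw [he]
  refine ⟨⟨congrArg (· + 1) h1, ?_, h3⟩, ?_, ?_⟩
  · simp only [Config.write, Finsupp.coe_update, h2]
    exact update_mem_lt hi
  · simp only [Config.write]; omega
  · simp only [Config.write, Finsupp.coe_update]
    exact hg.update (by omega) hv

theorem Reach.const {i v : ℕ} (hP : P[pc]? = some (.const i v))
    (next : Reach P E ⟨pc + 1, Function.update r i v, h, out⟩ t s')
    (hi : i < 32 := by decide) (hv : v ≤ 40 := by decide) :
    Reach P E ⟨pc, r, h, out⟩ (t + 1) s' := by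
  refine Reach.write hP hi (fun c hc hg => ⟨hv.trans E.V_ge, 1, E.κ_pos, rfl⟩) next

theorem Reach.copy {i j : ℕ} (hP : P[pc]? = some (.copy i j))
    (next : Reach P E ⟨pc + 1, Function.update r i (r j), h, out⟩ t s')
    (hi : i < 32 := by decide) (hj : j < 32 := by decide) :
    Reach P E ⟨pc, r, h, out⟩ (t + 1) s' := by
  refine Reach.write hP hi (fun c hc hg => ?_) next
  have e : c.reg j = r j := by rw [hc, mem_lt hj]
  exact ⟨e ▸ (hg j).1, 1, E.κ_pos, by simp only [Instr.exec, e]⟩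

theorem Reach.load {i j d : ℕ} (hP : P[pc]? = some (.load i j d)) (ha : 32 ≤ r j + d)
    (next : Reach P E ⟨pc + 1, Function.update r i (h (r j + d)), h, out⟩ t s')
    (hi : i < 32 := by decide) (hj : j < 32 := by decide) :
    Reach P E ⟨pc, r, h, out⟩ (t + 1) s' := by
  refine Reach.write hP hi (fun c hc hg => ?_) next
  have e : c.reg j = r j := by rw [hc, mem_lt hj]
  have e' : c.reg (r j + d) = h (r j + d) := by rw [hc, mem_ge ha]
  exact ⟨e' ▸ (hg _).1, 1, E.κ_pos, by simp only [Instr.exec, e, e']⟩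

theorem Reach.input {i j : ℕ} (hP : P[pc]? = some (.input i j))
    (next : Reach P E ⟨pc + 1, Function.update r i (E.x.getD (r j) 0), h, out⟩ t s')
    (hi : i < 32 := by decide) (hj : j < 32 := by decide) :
    Reach P E ⟨pc, r, h, out⟩ (t + 1) s' := by
  refine Reach.write hP hi (fun c hc hg => ?_) next
  have e : c.reg j = r j := by rw [hc, mem_lt hj]
  exact ⟨E.x_le _, 1, E.κ_pos, by simp only [Instr.exec, e]⟩

theorem size_le_of_le {a V : ℕ} (h : a ≤ V) : a.size ≤ V :=
  (Nat.size_le.2 Nat.lt_two_pow_self).trans h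

theorem Reach.add {i j k : ℕ} (hP : P[pc]? = some (.add i j k)) (hκ : 2 * E.V + 1 ≤ E.κ)
    (hv : r j + r k ≤ E.V)
    (next : Reach P E ⟨pc + 1, Function.update r i (r j + r k), h, out⟩ t s')
    (hi : i < 32 := by decide) (hj : j < 32 := by decide) (hk : k < 32 := by decide) :
    Reach P E ⟨pc, r, h, out⟩ (t + 1) s' := by
  refine Reach.write hP hi (fun c hc hg => ?_) next
  have e : c.reg j = r j := by rw [hc, mem_lt hj]
  have e' : c.reg k = r k := by rw [hc, mem_lt hk]
  have h1 := size_le_of_le (hg j).1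
  have h2 := size_le_of_le (hg k).1
  exact ⟨hv, 1 + (c.reg j).size + (c.reg k).size, by omega, by simp only [Instr.exec, e, e']⟩

theorem Reach.sub {i j k : ℕ} (hP : P[pc]? = some (.sub i j k)) (hκ : 2 * E.V + 1 ≤ E.κ)
    (next : Reach P E ⟨pc + 1, Function.update r i (r j - r k), h, out⟩ t s')
    (hi : i < 32 := by decide) (hj : j < 32 := by decide) (hk : k < 32 := by decide) :
    Reach P E ⟨pc, r, h, out⟩ (t + 1) s' := by
  refine Reach.write hP hi (fun c hc hg => ?_) next
  have e : c.reg j = r j := by rw [hc, mem_lt hj]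
  have e' : c.reg k = r k := by rw [hc, mem_lt hk]
  have h1 := size_le_of_le (hg j).1
  have h2 := size_le_of_le (hg k).1
  have h3 := (hg j).1
  exact ⟨by omega, 1 + (c.reg j).size + (c.reg k).size, by omega,
    by simp only [Instr.exec, e, e']⟩

theorem Reach.store {i d j : ℕ} (hP : P[pc]? = some (.store i d j)) (ha : 32 ≤ r i + d)
    (next : Reach P E ⟨pc + 1, r, Function.update h (r i + d) (r j), out⟩ t s')
    (hi : i < 32 := by decide) (hj : j < 32 := by decide) (hd : d < 40 := by decide) :
    Reach P E ⟨pc, r, h, out⟩ (t + 1) s' := by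
  refine Reach.step hP ?_ next
  rintro c ⟨h1, h2, h3⟩ hg
  have e : c.reg i = r i := by rw [h2, mem_lt hi]
  have e' : c.reg j = r j := by rw [h2, mem_lt hj]
  simp only [Instr.exec, e, e']
  have h4 := (hg i).1
  refine ⟨⟨congrArg (· + 1) h1, ?_, h3⟩, ?_, ?_⟩
  · simp only [Config.write, Finsupp.coe_update, h2]
    exact update_mem_ge ha
  · have := E.κ_pos
    simp only [Config.write]; omega
  · simp only [Config.write, Finsupp.coe_update]
    exact hg.update (by omega) (e' ▸ (hg j).1)

theorem Reach.jump {u : ℕ} (hP : P[pc]? = some (.jump u))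
    (next : Reach P E ⟨u, r, h, out⟩ t s') :
    Reach P E ⟨pc, r, h, out⟩ (t + 1) s' := by
  refine Reach.step hP ?_ next
  rintro c ⟨h1, h2, h3⟩ hg
  exact ⟨⟨rfl, h2, h3⟩, Nat.add_le_add_left E.κ_pos _, hg⟩

theorem Reach.jumpLt_of_lt {i j u : ℕ} (hP : P[pc]? = some (.jumpLt i j u)) (hlt : r i < r j)
    (next : Reach P E ⟨u, r, h, out⟩ t s')
    (hi : i < 32 := by decide) (hj : j < 32 := by decide) :
    Reach P E ⟨pc, r, h, out⟩ (t + 1) s' := by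
  refine Reach.step hP ?_ next
  rintro c ⟨h1, h2, h3⟩ hg
  refine ⟨⟨?_, h2, h3⟩, Nat.add_le_add_left E.κ_pos _, hg⟩
  simp only [Instr.exec]
  rw [h2, mem_lt hi, mem_lt hj, if_pos hlt]

theorem Reach.jumpLt_of_le {i j u : ℕ} (hP : P[pc]? = some (.jumpLt i j u)) (hle : r j ≤ r i)
    (next : Reach P E ⟨pc + 1, r, h, out⟩ t s')
    (hi : i < 32 := by decide) (hj : j < 32 := by decide) :
    Reach P E ⟨pc, r, h, out⟩ (t + 1) s' := by
  refine Reach.step hP ?_ next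
  rintro c ⟨h1, h2, h3⟩ hg
  refine ⟨⟨?_, h2, h3⟩, Nat.add_le_add_left E.κ_pos _, hg⟩
  simp only [Instr.exec]
  rw [h2, mem_lt hi, mem_lt hj, if_neg (not_lt.2 hle), h1]

theorem Reach.output {i j : ℕ} (hP : P[pc]? = some (.output i j)) (ha : 32 ≤ r i)
    (next : Reach P E ⟨pc + 1, r, h,
      out ++ [(List.range' (r i) (r j + 1 - r i)).map h]⟩ t s')
    (hi : i < 32 := by decide) (hj : j < 32 := by decide) :
    Reach P E ⟨pc, r, h, out⟩ (t + 1) s' := by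
  refine Reach.step hP ?_ next
  rintro c ⟨h1, h2, h3⟩ hg
  refine ⟨⟨congrArg (· + 1) h1, h2, ?_⟩, Nat.add_le_add_left E.κ_pos _, hg⟩
  simp only [Instr.exec]
  rw [h2, h3, mem_lt hi, mem_lt hj]
  congr 2
  refine List.map_congr_left fun a ha' => mem_ge ?_
  exact ha.trans (List.mem_range'_1.1 ha').1

end

/-! ### The program -/

/-- The program. The instructions `0` to `57` are the precomputation: they count the variables
(`5`), build the levels (`12`) and the states (`26`, with the search of an equal state at `36`),
and link the states of whole terms to a list (`50`). The others are the search: descend to the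
next level (`58`), give the current variable the value in `R_10` (`63`) and restrict the list of
states (`67`), go on after the branch for the value in `R_10` is finished (`81`), return to the
next higher level (`86`) and clear the list of states (`87`).

`R_0` to `R_4` hold the constants `0` to `4`, `R_5` the number of variables, and `R_6` and `R_7`
the first and the last address of the output block. In the search `R_8` is the current level,
`R_9` the one below it, `R_12` runs through a list of states, `R_13` is a restricted state and
`R_15` the first state of the list under construction. In the precomputation `R_13` is the state of
the letters of the term read so far, `R_17` the position on the input, `R_18` the number of letters
read of the term, `R_23` the next free record, and `R_20` runs through the records.

The search has no arithmetic instruction, since one would cost the logarithm of an address. -/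
def program : Program :=
  [.const 1 1, .const 2 2, .const 3 3, .const 4 4, .const 6 32,
   .input 16 5, .jumpLt 16 4 9, .add 5 5 1, .jump 5,
   .add 7 6 5, .copy 8 7, .copy 11 6,
   .add 24 8 4, .store 8 3 24, .store 24 2 8, .store 24 1 11, .copy 8 24, .add 11 11 1,
   .jumpLt 11 7 12,
   .sub 7 7 1, .add 22 8 4, .copy 13 22, .add 23 22 4, .copy 17 5, .const 15 1, .const 18 0,
   .input 16 17, .jumpLt 0 16 29, .jump 55,
   .jumpLt 16 2 32, .store 23 2 13, .jumpLt 16 3 33, .store 23 1 13,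
   .load 14 23 1, .load 19 23 2, .copy 20 22,
   .load 21 20 1, .jumpLt 21 14 43, .jumpLt 14 21 43, .load 21 20 2, .jumpLt 21 19 43,
   .jumpLt 19 21 43, .jump 45,
   .add 20 20 4, .jump 36,
   .copy 13 20, .add 23 23 4, .add 17 17 1, .add 18 18 1, .jumpLt 18 5 26,
   .store 13 0 15, .copy 15 13, .const 18 0, .copy 13 22, .jump 26,
   .jumpLt 1 15 57, .jump 98, .store 8 0 15,
   .load 9 8 2, .jumpLt 0 9 62, .output 6 7, .jump 86, .const 10 0,
   .load 11 8 1, .store 11 0 10, .const 15 1, .load 12 8 0,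
   .jumpLt 0 10 70, .load 13 12 1, .jump 71, .load 13 12 2, .jumpLt 0 13 73, .jump 77,
   .load 14 13 0, .jumpLt 0 14 77, .store 13 0 15, .copy 15 13,
   .load 12 12 0, .jumpLt 1 12 67, .store 9 0 15, .jumpLt 1 15 84,
   .jumpLt 0 10 86, .const 10 1, .jump 63, .copy 8 9, .jump 58,
   .load 12 8 0,
   .load 14 12 0, .store 12 0 0, .copy 12 14, .jumpLt 1 12 87,
   .load 8 8 3, .jumpLt 0 8 94, .jump 98, .load 11 8 1, .load 10 11 0, .load 9 8 2, .jump 81]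

/-! ### The contents of the heap -/

section

/-- The address of the `k`-th record. A record has four fields. The heap starts with the `n`
values of the variables, and the records follow. -/
def recAddr (n k : ℕ) : ℕ := 32 + n + 4 * k

/-- The address of the state `u`: the records `0` to `n` are those of the levels, and after them
come those of the words `recs`, which may have repetitions. -/
def ad (n : ℕ) (recs : List (List ℕ)) (u : List ℕ) : ℕ := recAddr n (n + 1 + recs.idxOf u)

/-- The address of the first state of a linked list, or `1` for the empty list. -/
def hd (n : ℕ) (recs : List (List ℕ)) : List (List ℕ) → ℕ
  | [] => 1
  | u :: _ => ad n recs u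

/-- The link of the state `u` if the list in memory is `l`: the address of its successor, `1` for
the last state of `l`, and `0` for a state that does not belong to `l`. -/
def link (n : ℕ) (recs : List (List ℕ)) : List (List ℕ) → List ℕ → ℕ
  | [], _ => 0
  | v :: l, u => if u = v then hd n recs l else link n recs l u

/-- The part of the heap that does not change during the search. A level has the fields: first
state of its list, address of the value of its variable, next lower level, next higher level.
A state has the fields: link, restriction to the value `false`, restriction to `true`. -/
structure Static (n : ℕ) (recs : List (List ℕ)) (h : ℕ → ℕ) : Prop where
  bit : ∀ j < n, h (recAddr n (j + 1) + 1) = 32 + j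
  down_zero : h (recAddr n 0 + 2) = 0
  down : ∀ j < n, h (recAddr n (j + 1) + 2) = recAddr n j
  up : ∀ j < n, h (recAddr n j + 3) = recAddr n (j + 1)
  up_last : h (recAddr n n + 3) = 0
  tail_mem : ∀ ℓ u, ℓ :: u ∈ recs → u ∈ recs
  child_false : ∀ ℓ u, ℓ :: u ∈ recs →
    h (ad n recs (ℓ :: u) + 1) = if allows ℓ false = true then ad n recs u else 0
  child_true : ∀ ℓ u, ℓ :: u ∈ recs →
    h (ad n recs (ℓ :: u) + 2) = if allows ℓ true = true then ad n recs u else 0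

/-- The links in the heap are those of the lists `lists j` of states of length `j`. -/
def Dyn (n : ℕ) (recs : List (List ℕ)) (h : ℕ → ℕ) (lists : ℕ → List (List ℕ)) : Prop :=
  ∀ u ∈ recs, h (ad n recs u) = link n recs (lists u.length) u

variable {n : ℕ} {recs : List (List ℕ)} {h : ℕ → ℕ} {lists : ℕ → List (List ℕ)}

/-- Equal restrictions share one record, so the address determines the word. -/
theorem ad_inj {u v : List ℕ} (hu : u ∈ recs) (huv : ad n recs u = ad n recs v) : u = v := by
  unfold ad recAddr at huv
  exact (List.idxOf_inj hu).1 (by omega)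

theorem hd_pos (l : List (List ℕ)) : 0 < hd n recs l := by
  cases l <;> simp [hd, ad, recAddr]

theorem one_lt_hd {l : List (List ℕ)} (hl : l ≠ []) : 1 < hd n recs l := by
  cases l with
  | nil => exact absurd rfl hl
  | cons => simp only [hd, ad, recAddr]; omega

theorem link_of_not_mem {l : List (List ℕ)} {u : List ℕ} (hu : u ∉ l) :
    link n recs l u = 0 := by
  induction l with
  | nil => rfl
  | cons v l ih =>
    rw [List.mem_cons, not_or] at hu
    rw [link, if_neg hu.1, ih hu.2]

theorem link_pos {l : List (List ℕ)} {u : List ℕ} (hu : u ∈ l) : 0 < link n recs l u := by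
  induction l with
  | nil => simp at hu
  | cons v l ih =>
    rw [link]
    split_ifs with h
    · exact hd_pos l
    · exact ih ((List.mem_cons.1 hu).resolve_left h)

/-- The successor of a state is found through its link. -/
theorem link_append {pre post : List (List ℕ)} {u : List ℕ} (hu : u ∉ pre) :
    link n recs (pre ++ u :: post) u = hd n recs post := by
  induction pre with
  | nil => simp [link]
  | cons v l ih =>
    rw [List.mem_cons, not_or] at hu
    rw [List.cons_append, link, if_neg hu.1, ih hu.2]

theorem Static.update (hs : Static n recs h) {a v : ℕ}
    (ha : a < 32 + n ∨ ∃ k, a = recAddr n k) : Static n recs (Function.update h a v) := by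
  have key : ∀ k d, 0 < d → d < 4 → Function.update h a v (recAddr n k + d) = h (recAddr n k + d) := by
    intro k d h0 h4
    refine Function.update_of_ne ?_ _ _
    rcases ha with ha | ⟨k', rfl⟩ <;> unfold recAddr at * <;> omega
  constructor
  · intro j hj; rw [key _ _ (by omega) (by omega)]; exact hs.bit j hj
  · rw [key _ _ (by omega) (by omega)]; exact hs.down_zero
  · intro j hj; rw [key _ _ (by omega) (by omega)]; exact hs.down j hj
  · intro j hj; rw [key _ _ (by omega) (by omega)]; exact hs.up j hj
  · rw [key _ _ (by omega) (by omega)]; exact hs.up_last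
  · exact hs.tail_mem
  · intro ℓ u hu; rw [ad, key _ _ (by omega) (by omega)]; exact hs.child_false ℓ u hu
  · intro ℓ u hu; rw [ad, key _ _ (by omega) (by omega)]; exact hs.child_true ℓ u hu

theorem Dyn.update_low (hd : Dyn n recs h lists) {a v : ℕ} (ha : a < recAddr n (n + 1)) :
    Dyn n recs (Function.update h a v) lists := by
  intro u hu
  rw [Function.update_of_ne, hd u hu]
  unfold ad recAddr at *
  omega

/-- Linking a new state before the list. -/
theorem Dyn.push {j : ℕ} {acc : List (List ℕ)} {u : List ℕ}
    (hd' : Dyn n recs h (Function.update lists j acc)) (hu : u ∈ recs) (hj : u.length = j) :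
    Dyn n recs (Function.update h (ad n recs u) (hd n recs acc))
      (Function.update lists j (u :: acc)) := by
  intro v hv
  by_cases huv : v = u
  · subst huv
    simp [hj, link]
  · rw [Function.update_of_ne (fun e => huv (ad_inj hv e)), hd' v hv]
    by_cases hvj : v.length = j
    · simp [hvj, link, huv]
    · simp [Function.update_of_ne hvj]

/-- Removing the first state of the list. -/
theorem Dyn.pop {j : ℕ} {post : List (List ℕ)} {u : List ℕ}
    (hd' : Dyn n recs h (Function.update lists j (u :: post))) (hj : u.length = j)
    (hup : u ∉ post) :
    Dyn n recs (Function.update h (ad n recs u) 0) (Function.update lists j post) := by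
  intro v hv
  by_cases huv : v = u
  · subst huv
    simp [hj, link_of_not_mem hup]
  · rw [Function.update_of_ne (fun e => huv (ad_inj hv e)), hd' v hv]
    by_cases hvj : v.length = j
    · simp [hvj, link, huv]
    · simp [Function.update_of_ne hvj]

/-- The list `A` consists of different states of length `j`. -/
structure IsStates (recs : List (List ℕ)) (j : ℕ) (A : List (List ℕ)) : Prop where
  nodup : A.Nodup
  mem : ∀ u ∈ A, u ∈ recs
  len : ∀ u ∈ A, u.length = j

theorem IsStates.restrict {j : ℕ} {A : List (List ℕ)} (hs : Static n recs h)
    (hA : IsStates recs (j + 1) A) (b : Bool) : IsStates recs j (restrict b A) := by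
  refine ⟨nodup_restrict b A, fun u hu => ?_, fun u hu => ?_⟩
  · obtain ⟨ℓ, hℓ, -⟩ := mem_restrict.1 hu
    exact hs.tail_mem ℓ u (hA.mem _ hℓ)
  · obtain ⟨ℓ, hℓ, -⟩ := mem_restrict.1 hu
    simpa using hA.len _ hℓ

/-! ### The search -/

variable {E : Env} {r : ℕ → ℕ} {out : List (List ℕ)}

/-- One state `ℓ :: u` of the list is restricted to the value `b`. -/
theorem reach_scan_step {b : Bool} {j ℓ : ℕ} {u : List ℕ} {pre post acc : List (List ℕ)}
    (hs : Static n recs h) (hdyn : Dyn n recs h (Function.update lists j acc))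
    (hA : IsStates recs (j + 1) (lists (j + 1))) (hsplit : lists (j + 1) = pre ++ (ℓ :: u) :: post)
    (h0 : r 0 = 0) (h10 : r 10 = b.toNat) (h12 : r 12 = ad n recs (ℓ :: u))
    (h15 : r 15 = hd n recs acc) :
    ∃ r' h', Reach program E ⟨67, r, h, out⟩ 9 ⟨78, r', h', out⟩ ∧ Static n recs h' ∧
      Dyn n recs h' (Function.update lists j (push b acc (ℓ :: u))) ∧
      r' 12 = hd n recs post ∧ r' 15 = hd n recs (push b acc (ℓ :: u)) ∧
      (∀ i < 12, r' i = r i) ∧ ∀ a < recAddr n (n + 1), h' a = h a := by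
  have hmem : ℓ :: u ∈ recs := hA.mem _ (by rw [hsplit]; simp)
  have hu : u ∈ recs := hs.tail_mem ℓ u hmem
  have hlen : (ℓ :: u).length = j + 1 := hA.len _ (by rw [hsplit]; simp)
  have hj : u.length = j := by simpa using hlen
  have hpre : ℓ :: u ∉ pre := by
    have := hA.nodup
    rw [hsplit] at this
    intro hp
    exact (List.nodup_append.1 this).2.2 _ hp _ (List.mem_cons_self ..) rfl
  have hnext : h (ad n recs (ℓ :: u)) = hd n recs post := by
    rw [hdyn _ hmem, hlen, Function.update_of_ne (by omega), hsplit, link_append hpre]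
  have hlink : h (ad n recs u) = link n recs acc u := by
    rw [hdyn _ hu, hj, Function.update_self]
  have had : ∀ w, 32 ≤ ad n recs w := fun w => by unfold ad recAddr; omega
  have hne : ad n recs (ℓ :: u) ≠ ad n recs u := fun e => by
    have := ad_inj hmem e
    simp at this
  -- the restriction is loaded into `R_13`
  obtain ⟨r1, R1, e13, e1⟩ : ∃ r1, Reach program E ⟨67, r, h, out⟩ 3 ⟨71, r1, h, out⟩ ∧
      r1 13 = (if allows ℓ b = true then ad n recs u else 0) ∧ ∀ i, i ≠ 13 → r1 i = r i := by
    cases b with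
    | false =>
      refine ⟨_, Reach.jumpLt_of_le rfl (by rw [h0, h10]; simp) <| Reach.load rfl (by
        have := had (ℓ :: u); omega) <| Reach.jump rfl Reach.refl, ?_, ?_⟩
      · simp [h12, hs.child_false ℓ u hmem]
      · intro i hi
        simp [hi]
    | true =>
      refine ⟨_, Reach.jumpLt_of_lt rfl (by rw [h0, h10]; simp) <| Reach.load rfl (by
        have := had (ℓ :: u); omega) <| Reach.refl, ?_, ?_⟩
      · simp [h12, hs.child_true ℓ u hmem]
      · intro i hi
        simp [hi]
  have e12 : r1 12 = ad n recs (ℓ :: u) := by rw [e1 12 (by decide), h12]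
  have e15 : r1 15 = hd n recs acc := by rw [e1 15 (by decide), h15]
  have e0 : r1 0 = 0 := by rw [e1 0 (by decide), h0]
  by_cases hal : allows ℓ b = true
  · rw [if_pos hal] at e13
    by_cases hacc : u ∈ acc
    · have hp : push b acc (ℓ :: u) = acc := by simp [push, hacc]
      have hpos := link_pos (n := n) (recs := recs) hacc
      rw [hp]
      refine ⟨_, _, R1.trans (t' := 6) <| Reach.jumpLt_of_lt rfl ?_ <| Reach.load rfl ?_ <|
        Reach.jumpLt_of_lt rfl ?_ <| Reach.load rfl ?_ <| Reach.refl, hs, hdyn, ?_, ?_, ?_, ?_⟩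
      · have := had u; omega
      · have := had u; omega
      · simp [e0, e13, hlink, hpos]
      · have := had (ℓ :: u); simp; omega
      · simp [e12, hnext]
      · simp [e15]
      · intro i hi
        have i1 : i ≠ 12 := by omega
        have i2 : i ≠ 14 := by omega
        simp [i1, i2, e1 i (by omega)]
      · simp
    · have hp : push b acc (ℓ :: u) = u :: acc := by simp [push, hacc, hal]
      have hz := link_of_not_mem (n := n) (recs := recs) hacc
      rw [hp]
      refine ⟨_, _, R1.trans (t' := 6) <| Reach.jumpLt_of_lt rfl ?_ <| Reach.load rfl ?_ <|
        Reach.jumpLt_of_le rfl ?_ <| Reach.store rfl ?_ <| Reach.copy rfl <|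
        Reach.load rfl ?_ <| Reach.refl, hs.update ?_, ?_, ?_, ?_, ?_, ?_⟩
      · have := had u; omega
      · have := had u; omega
      · simp [e0, e13, hlink, hz]
      · have := had u; simp; omega
      · have := had (ℓ :: u); simp; omega
      · exact Or.inr ⟨n + 1 + recs.idxOf u, by simp [e13, ad]⟩
      · simpa [e13, e15] using hdyn.push hu hj
      · simp [e12, e13, hnext, hne]
      · simp [e13, hd]
      · intro i hi
        have i1 : i ≠ 12 := by omega
        have i2 : i ≠ 14 := by omega
        have i3 : i ≠ 15 := by omega
        simp [i1, i2, i3, e1 i (by omega)]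
      · intro a ha
        refine Function.update_of_ne ?_ _ _
        simp [e13, ad, recAddr] at ha ⊢
        omega
  · rw [if_neg hal] at e13
    have hp : push b acc (ℓ :: u) = acc := by simp [push, hal]
    rw [hp]
    refine ⟨_, _, R1.trans (t' := 6) <| Reach.jumpLt_of_le rfl ?_ <| Reach.jump rfl <|
      Reach.load rfl ?_ <| Reach.refl, hs, hdyn, ?_, ?_, ?_, ?_⟩
    · omega
    · have := had (ℓ :: u); omega
    · simp [e12, hnext]
    · simp [e15]
    · intro i hi
      have i1 : i ≠ 12 := by omega
      simp [i1, e1 i (by omega)]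
    · simp

/-- The new list is built in front of `acc` while the rest of the list of level `j + 1` is read.
Links are not only the list structure, but also tell which states are in the new list already. -/
theorem reach_scan {b : Bool} {j : ℕ} (hA : IsStates recs (j + 1) (lists (j + 1)))
    (rest : List (List ℕ)) : ∀ (pre acc : List (List ℕ)) (r h : ℕ → ℕ), rest ≠ [] →
    lists (j + 1) = pre ++ rest → Static n recs h → Dyn n recs h (Function.update lists j acc) →
    r 0 = 0 → r 1 = 1 → r 10 = b.toNat → r 12 = hd n recs rest → r 15 = hd n recs acc →
    ∃ r' h', Reach program E ⟨67, r, h, out⟩ (10 * rest.length) ⟨79, r', h', out⟩ ∧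
      Static n recs h' ∧
      Dyn n recs h' (Function.update lists j (rest.foldl (push b) acc)) ∧
      r' 15 = hd n recs (rest.foldl (push b) acc) ∧
      (∀ i < 12, r' i = r i) ∧ ∀ a < recAddr n (n + 1), h' a = h a := by
  induction rest with
  | nil => intro _ _ _ _ h; exact absurd rfl h
  | cons w rest ih =>
    intro pre acc r h _ hsplit hs hdyn h0 h1 h10 h12 h15
    have hlen : w.length = j + 1 := hA.len w (by rw [hsplit]; simp)
    obtain ⟨ℓ, u, rfl⟩ := List.exists_cons_of_length_eq_add_one hlen
    obtain ⟨r1, h1', R1, hs1, hd1, e12, e15, er, eh⟩ :=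
      reach_scan_step (E := E) (out := out) hs hdyn hA hsplit h0 h10 h12 h15
    by_cases hrest : rest = []
    · subst hrest
      refine ⟨_, _, (R1.trans (t' := 1) <| Reach.jumpLt_of_le rfl ?_ <| Reach.refl).mono ?_,
        hs1, hd1, e15, er, eh⟩
      · rw [e12, er 1 (by decide), h1, hd]
      · simp
    · obtain ⟨r2, h2, R2, hs2, hd2, e15', er', eh'⟩ := ih (pre ++ [ℓ :: u]) _ r1 h1' hrest
        (by simp [hsplit]) hs1 hd1 (by rw [er 0 (by decide), h0]) (by rw [er 1 (by decide), h1])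
        (by rw [er 10 (by decide), h10]) e12 e15
      refine ⟨r2, h2, (R1.trans <| Reach.jumpLt_of_lt rfl ?_ R2).mono ?_,
        hs2, hd2, e15', ?_, ?_⟩
      · rw [e12, er 1 (by decide), h1]
        exact one_lt_hd hrest
      · simp; omega
      · intro i hi; rw [er' i hi, er i hi]
      · intro a ha; rw [eh' a ha, eh a ha]

/-- Clearing the links of a list. -/
theorem reach_clear {j : ℕ} (l : List (List ℕ)) : ∀ (r h : ℕ → ℕ), l ≠ [] →
    IsStates recs j l → Static n recs h → Dyn n recs h (Function.update lists j l) →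
    r 0 = 0 → r 1 = 1 → r 12 = hd n recs l →
    ∃ r' h', Reach program E ⟨87, r, h, out⟩ (4 * l.length) ⟨91, r', h', out⟩ ∧
      Static n recs h' ∧ Dyn n recs h' (Function.update lists j []) ∧
      (∀ i < 12, r' i = r i) ∧ ∀ a < recAddr n (n + 1), h' a = h a := by
  induction l with
  | nil => intro _ _ h; exact absurd rfl h
  | cons w l ih =>
    intro r h _ hA hs hdyn h0 h1 h12
    have had : 32 ≤ ad n recs w := by unfold ad recAddr; omega
    have hwl : w ∉ l := (List.nodup_cons.1 hA.nodup).1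
    have hwj : w.length = j := hA.len w (by simp)
    have hnext : h (ad n recs w) = hd n recs l := by
      rw [hdyn _ (hA.mem w (by simp)), hwj, Function.update_self]
      simp [link]
    rw [hd] at h12
    have hs' : Static n recs (Function.update h (ad n recs w) 0) := hs.update (Or.inr ⟨_, rfl⟩)
    have hd' := hdyn.pop hwj hwl
    have eh : ∀ a < recAddr n (n + 1), Function.update h (ad n recs w) 0 a = h a := by
      intro a ha
      refine Function.update_of_ne ?_ _ _
      unfold ad recAddr at *
      omega
    obtain ⟨r1, R1, e12, er⟩ : ∃ r1, Reach program E ⟨87, r, h, out⟩ 3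
        ⟨90, r1, Function.update h (ad n recs w) 0, out⟩ ∧ r1 12 = hd n recs l ∧
        ∀ i < 12, r1 i = r i := by
      refine ⟨Function.update (Function.update r 14 (hd n recs l)) 12 (hd n recs l), ?_, ?_, ?_⟩
      · have := Reach.load (P := program) (E := E) (pc := 87) (r := r) (h := h) (out := out)
          (t := 2) rfl (by omega) <| Reach.store rfl (by simp; omega) <| Reach.copy rfl <|
          Reach.refl
        simpa [h12, hnext, h0] using this
      · simp
      · intro i hi
        have i1 : i ≠ 12 := by omega
        have i2 : i ≠ 14 := by omega
        simp [i1, i2]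
    by_cases hl : l = []
    · subst hl
      refine ⟨_, _, (R1.trans (t' := 1) <| Reach.jumpLt_of_le rfl ?_ <| Reach.refl).mono ?_,
        hs', hd', er, eh⟩
      · rw [e12, er 1 (by decide), h1, hd]
      · simp
    · obtain ⟨r2, h2, R2, hs2, hd2, er', eh'⟩ := ih r1 _ hl
        ⟨(List.nodup_cons.1 hA.nodup).2, fun u hu => hA.mem u (by simp [hu]),
          fun u hu => hA.len u (by simp [hu])⟩ hs' hd' (by rw [er 0 (by decide), h0])
        (by rw [er 1 (by decide), h1]) e12
      refine ⟨r2, h2, (R1.trans <| Reach.jumpLt_of_lt rfl ?_ R2).mono ?_,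
        hs2, hd2, ?_, ?_⟩
      · rw [e12, er 1 (by decide), h1]
        exact one_lt_hd hl
      · simp; omega
      · intro i hi; rw [er' i hi, er i hi]
      · intro a ha; rw [eh' a ha, eh a ha]

/-- The word of the assignment that gives the variables below `j` the values `v`, in descending
order of the variables, and the others the values in the heap `h`. -/
def outWord (n j : ℕ) (h : ℕ → ℕ) (v : List Bool) : List ℕ :=
  v.reverse.map Bool.toNat ++ (List.range' (32 + j) (n - j)).map h

theorem outWord_cons {j : ℕ} (hj : j < n) {h h' : ℕ → ℕ} {b : Bool} {v : List Bool}
    (hb : h' (32 + j) = b.toNat) (hh : ∀ i, j < i → i < n → h' (32 + i) = h (32 + i)) :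
    outWord n j h' v = outWord n (j + 1) h (b :: v) := by
  unfold outWord
  obtain ⟨k, hk⟩ := Nat.exists_eq_add_of_lt hj
  have e1 : n - j = k + 1 := by omega
  have e2 : n - (j + 1) = k := by omega
  rw [e1, e2, List.range'_succ]
  simp only [List.map_cons, hb, List.reverse_cons, List.map_append, List.append_assoc]
  have : (List.range' (32 + j + 1) k).map h' = (List.range' (32 + (j + 1)) k).map h := by
    refine List.map_congr_left fun a ha => ?_
    have ha := List.mem_range'_1.1 ha
    have := hh (a - 32) (by omega) (by omega)
    rwa [show 32 + (a - 32) = a by omega] at this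
  rw [this]
  simp

/-- The registers that are constant during the search. -/
structure Consts (n : ℕ) (r : ℕ → ℕ) : Prop where
  zero : r 0 = 0
  one : r 1 = 1
  lo : r 6 = 32
  hi : r 7 = 31 + n

theorem Consts.congr {r r' : ℕ → ℕ} (hr : Consts n r) (hrr : ∀ i < 8, r' i = r i) :
    Consts n r' :=
  ⟨by rw [hrr 0 (by decide), hr.zero], by rw [hrr 1 (by decide), hr.one],
    by rw [hrr 6 (by decide), hr.lo], by rw [hrr 7 (by decide), hr.hi]⟩

/-- What the search does below level `j`: from the instruction `58` with the list of this level
in memory and no lists in the lower levels, it gets to the instruction `86` in the same situation,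
having output the models of the list of this level. -/
def Searches (n : ℕ) (recs : List (List ℕ)) (E : Env) (j : ℕ) : Prop :=
  ∀ (lists : ℕ → List (List ℕ)) (r h : ℕ → ℕ) (out : List (List ℕ)), Static n recs h →
    Dyn n recs h lists → Consts n r → r 8 = recAddr n j → (∀ i < j, lists i = []) →
    lists j ≠ [] → IsStates recs j (lists j) → h (recAddr n j) = hd n recs (lists j) →
    ∃ r' h', Reach program E ⟨58, r, h, out⟩ (cost j (lists j))
      ⟨86, r', h', out ++ (enum j (lists j)).map (outWord n j h)⟩ ∧
      Static n recs h' ∧ Dyn n recs h' lists ∧ Consts n r' ∧ r' 8 = recAddr n j ∧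
      (∀ i, j ≤ i → i < n → h' (32 + i) = h (32 + i)) ∧
      ∀ i, j ≤ i → i ≤ n → h' (recAddr n i) = h (recAddr n i)

/-- Return from a lower level. -/
theorem reach_return {j : ℕ} (hj : j < n) (hs : Static n recs h) (hdyn : Dyn n recs h lists)
    (hr : Consts n r) (h8 : r 8 = recAddr n j) (hne : lists j ≠ [])
    (hA : IsStates recs j (lists j)) (hhd : h (recAddr n j) = hd n recs (lists j)) :
    ∃ r' h', Reach program E ⟨86, r, h, out⟩ (4 * (lists j).length + 7) ⟨81, r', h', out⟩ ∧
      Static n recs h' ∧ Dyn n recs h' (Function.update lists j []) ∧ Consts n r' ∧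
      r' 8 = recAddr n (j + 1) ∧ r' 9 = recAddr n j ∧ r' 10 = h (32 + j) ∧
      ∀ a < recAddr n (n + 1), h' a = h a := by
  have hra : ∀ k, 32 ≤ recAddr n k := fun k => by unfold recAddr; omega
  have hlow : ∀ k ≤ n, ∀ d < 4, recAddr n k + d < recAddr n (n + 1) := by
    intro k hk d hd; unfold recAddr; omega
  obtain ⟨r1, h1, R1, hs1, hd1, er, eh⟩ := reach_clear (E := E) (lists := lists) (out := out)
    (lists j) (Function.update r 12 (hd n recs (lists j))) h hne hA hs (by simpa using hdyn)
    (by simp [hr.zero]) (by simp [hr.one]) (by simp)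
  have e8 : r1 8 = recAddr n j := by rw [er 8 (by decide)]; simp [h8]
  have e0 : r1 0 = 0 := by rw [er 0 (by decide)]; simp [hr.zero]
  have eup : h1 (recAddr n j + 3) = recAddr n (j + 1) := hs1.up j hj
  have ebit : h1 (recAddr n (j + 1) + 1) = 32 + j := hs1.bit j hj
  have edown : h1 (recAddr n (j + 1) + 2) = recAddr n j := hs1.down j hj
  have eb : h1 (32 + j) = h (32 + j) := eh _ (by unfold recAddr; omega)
  have h32 := hra j
  have h32' := hra (j + 1)
  have R0 : Reach program E ⟨86, r, h, out⟩ 1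
      ⟨87, Function.update r 12 (hd n recs (lists j)), h, out⟩ := by
    have := Reach.load (P := program) (E := E) (pc := 86) (r := r) (h := h) (out := out)
      (t := 0) rfl (by omega) Reach.refl
    simpa [h8, hhd] using this
  refine ⟨_, h1, ((R0.trans R1).trans (t' := 6) <| Reach.load rfl ?_ <|
    Reach.jumpLt_of_lt rfl ?_ <| Reach.load rfl ?_ <| Reach.load rfl ?_ <| Reach.load rfl ?_ <|
    Reach.jump rfl Reach.refl).mono (by omega), hs1, hd1, ?_, ?_, ?_, ?_, eh⟩
  · omega
  · simp [e0, e8, eup]; omega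
  · simp [e8, eup]; omega
  · simp [e8, eup, ebit]
  · simp [e8, eup]; omega
  · refine hr.congr fun i hi => ?_
    have i1 : i ≠ 8 := by omega
    have i2 : i ≠ 9 := by omega
    have i3 : i ≠ 10 := by omega
    have i4 : i ≠ 11 := by omega
    have i5 : i ≠ 12 := by omega
    simp [i1, i2, i3, i4, er i (by omega), i5]
  · simp [e8, eup]
  · simp [e8, eup, edown]
  · simp [e8, eup, ebit, eb]

/-- The branch of the search at level `j + 1` with the value `b` for the variable `j`. -/
theorem reach_branch {j : ℕ} (hj : j < n) (IH : Searches n recs E j) {b : Bool}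
    (hs : Static n recs h) (hdyn : Dyn n recs h lists)
    (hr : Consts n r) (h8 : r 8 = recAddr n (j + 1)) (h9 : r 9 = recAddr n j)
    (h10 : r 10 = b.toNat) (hlow : ∀ i < j + 1, lists i = []) (hne : lists (j + 1) ≠ [])
    (hA : IsStates recs (j + 1) (lists (j + 1)))
    (hhd : h (recAddr n (j + 1)) = hd n recs (lists (j + 1))) :
    ∃ r' h', Reach program E ⟨63, r, h, out⟩ (29 * (lists (j + 1)).length +
        if restrict b (lists (j + 1)) = [] then 0 else cost j (restrict b (lists (j + 1))))
      ⟨81, r', h', out ++ (if restrict b (lists (j + 1)) = [] then [] else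
        (enum j (restrict b (lists (j + 1)))).map (b :: ·)).map (outWord n (j + 1) h)⟩ ∧
      Static n recs h' ∧ Dyn n recs h' lists ∧ Consts n r' ∧ r' 8 = recAddr n (j + 1) ∧
      r' 9 = recAddr n j ∧ r' 10 = b.toNat ∧
      (∀ i, j + 1 ≤ i → i < n → h' (32 + i) = h (32 + i)) ∧
      ∀ i, j + 1 ≤ i → i ≤ n → h' (recAddr n i) = h (recAddr n i) := by
  have hpos : 1 ≤ (lists (j + 1)).length := List.length_pos_iff.2 hne
  have hupd : Function.update lists j [] = lists := by
    rw [← hlow j (by omega)]; exact Function.update_eq_self _ _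
  have h32 : 32 ≤ recAddr n (j + 1) := by unfold recAddr; omega
  have h32' : 32 ≤ recAddr n j := by unfold recAddr; omega
  -- the value `b` is stored, and the list is scanned
  obtain ⟨r0, R0, e12, e15, er0⟩ : ∃ r0, Reach program E ⟨63, r, h, out⟩ 4
      ⟨67, r0, Function.update h (32 + j) b.toNat, out⟩ ∧
      r0 12 = hd n recs (lists (j + 1)) ∧ r0 15 = 1 ∧ ∀ i < 11, r0 i = r i := by
    have := Reach.load (P := program) (E := E) (pc := 63) (r := r) (h := h) (out := out)
      (t := 3) rfl (by omega) <| Reach.store rfl (by simp [h8, hs.bit j hj]) <|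
      Reach.const rfl <| Reach.load rfl (by simp; omega) <| Reach.refl
    have ne1 : recAddr n (j + 1) ≠ 32 + j := by unfold recAddr; omega
    simp [h8, hs.bit j hj, h10, ne1, hhd] at this
    refine ⟨_, this, by simp, by simp, fun i hi => ?_⟩
    have i1 : i ≠ 11 := by omega
    have i2 : i ≠ 12 := by omega
    have i3 : i ≠ 15 := by omega
    simp [i1, i2, i3]
  have hbase : ∀ a, 32 + n ≤ a → Function.update h (32 + j) b.toNat a = h a :=
    fun a ha => Function.update_of_ne (by omega) _ _
  obtain ⟨r1, h1, R1, hs1, hd1, e15', er1, eh1⟩ := reach_scan (E := E) (out := out) (b := b) hA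
    (lists (j + 1)) [] [] r0 (Function.update h (32 + j) b.toNat) hne rfl
    (hs.update (Or.inl (by omega)))
    (by rw [hupd]; exact hdyn.update_low (by unfold recAddr; omega))
    (by rw [er0 0 (by decide), hr.zero]) (by rw [er0 1 (by decide), hr.one])
    (by rw [er0 10 (by decide), h10]) e12 e15
  change Dyn n recs h1 (Function.update lists j (restrict b (lists (j + 1)))) at hd1
  change r1 15 = hd n recs (restrict b (lists (j + 1))) at e15'
  have hB := hA.restrict hs b
  set B := restrict b (lists (j + 1)) with hBdef
  have er : ∀ i < 11, r1 i = r i := fun i hi => by rw [er1 i (by omega), er0 i hi]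
  have hr1 : Consts n r1 := hr.congr fun i hi => er i (by omega)
  have e9 : r1 9 = recAddr n j := by rw [er 9 (by decide), h9]
  -- the new list becomes the one of level `j`
  set h2 := Function.update h1 (recAddr n j) (hd n recs B) with hh2
  have hs2 : Static n recs h2 := hs1.update (Or.inr ⟨_, rfl⟩)
  have hd2 : Dyn n recs h2 (Function.update lists j B) := by
    refine hd1.update_low ?_
    unfold recAddr; omega
  have R2 : Reach program E ⟨79, r1, h1, out⟩ 1 ⟨80, r1, h2, out⟩ := by
    have := Reach.store (P := program) (E := E) (pc := 79) (r := r1) (h := h1) (out := out)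
      (t := 0) rfl (by omega) Reach.refl
    simpa [e9, e15'] using this
  have ebit : ∀ i < n, h2 (32 + i) = Function.update h (32 + j) b.toNat (32 + i) := by
    intro i hi
    rw [hh2, Function.update_of_ne (by unfold recAddr; omega), eh1 _ (by unfold recAddr; omega)]
  have ebit' : ∀ i, j + 1 ≤ i → i < n → h2 (32 + i) = h (32 + i) := by
    intro i hi hin
    rw [ebit i hin, Function.update_of_ne (by omega)]
  have ebitj : h2 (32 + j) = b.toNat := by rw [ebit j hj, Function.update_self]
  have erec : ∀ i, j + 1 ≤ i → i ≤ n → h2 (recAddr n i) = h (recAddr n i) := by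
    intro i hi hin
    rw [hh2, Function.update_of_ne (by unfold recAddr; omega), eh1 _ (by unfold recAddr; omega),
      hbase _ (by unfold recAddr; omega)]
  have RR := (R0.trans R1).trans R2
  by_cases hBe : B = []
  · refine ⟨r1, h2, (RR.trans (t' := 1) <| Reach.jumpLt_of_le rfl ?_ ?_).mono ?_, hs2, ?_,
      hr1, ?_, e9, ?_, ebit', erec⟩
    · rw [e15', hBe, hr1.one, hd]
    · rw [if_pos hBe]; simpa using Reach.refl
    · rw [if_pos hBe]; omega
    · rw [hBe, hupd] at hd2; exact hd2
    · rw [er 8 (by decide), h8]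
    · rw [er 10 (by decide), h10]
  · obtain ⟨r3, h3, R3, hs3, hd3, hr3, e8', eb3, erec3⟩ := IH (Function.update lists j B)
      (Function.update r1 8 (recAddr n j)) h2 out hs2 hd2
      (hr1.congr fun i hi => by simp [show i ≠ 8 by omega]) (by simp)
      (fun i hi => by rw [Function.update_of_ne (by omega)]; exact hlow i (by omega))
      (by simpa using hBe) (by simpa using hB) (by simp [hh2])
    simp only [Function.update_self] at R3
    have hrr3 : h3 (recAddr n j) = hd n recs B := by
      rw [erec3 j le_rfl hj.le, hh2, Function.update_self]
    obtain ⟨r4, h4, R4, hs4, hd4, hr4, f8, f9, f10, eh4⟩ := reach_return (E := E) (h := h3)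
      (lists := Function.update lists j B) (r := r3)
      (out := out ++ (enum j B).map (outWord n j h2)) hj hs3 hd3 hr3 e8' (by simpa using hBe)
      (by simpa using hB) (by simpa using hrr3)
    simp only [Function.update_self, Function.update_idem, hupd] at R4 hd4
    have hout : (enum j B).map (outWord n j h2) =
        ((enum j B).map (b :: ·)).map (outWord n (j + 1) h) := by
      rw [List.map_map]
      exact List.map_congr_left fun v _ => outWord_cons hj ebitj (fun i hi => ebit' i hi)
    rw [hout] at R3 R4
    have hBlen : B.length ≤ (lists (j + 1)).length := length_restrict_le b _
    have R80 : Reach program E ⟨80, r1, h2, out⟩ 3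
        ⟨58, Function.update r1 8 (recAddr n j), h2, out⟩ := by
      have := Reach.jumpLt_of_lt (P := program) (E := E) (pc := 80) (r := r1) (h := h2)
        (out := out) (t := 2) rfl (by rw [e15', hr1.one]; exact one_lt_hd hBe) <|
        Reach.copy rfl <| Reach.jump rfl <| Reach.refl
      simpa [e9] using this
    refine ⟨r4, h4, ?_, hs4, hd4, hr4, f8, f9, ?_, ?_, ?_⟩
    · rw [if_neg hBe, if_neg hBe]
      refine (((RR.trans R80).trans R3).trans R4).mono ?_
      omega
    · rw [f10, eb3 j le_rfl hj, ebitj]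
    · intro i hi hin
      rw [eh4 _ (by unfold recAddr; omega), eb3 i (by omega) hin, ebit' i hi hin]
    · intro i hi hin
      rw [eh4 _ (by unfold recAddr; omega), erec3 i (by omega) hin, erec i hi hin]

/-- Both values are tried in turn; at level `0` the values of the variables are output. -/
theorem searches (j : ℕ) (hj : j ≤ n) : Searches n recs E j := by
  induction j with
  | zero =>
    intro lists r h out hs hdyn hr h8 hlow hne hA hhd
    have h32 : 32 ≤ recAddr n 0 := by unfold recAddr; omega
    have hout : (List.range' (r 6) (r 7 + 1 - r 6)).map h = outWord n 0 h [] := by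
      rw [hr.lo, hr.hi, show 31 + n + 1 - 32 = n by omega]
      simp [outWord]
    have R := Reach.load (P := program) (E := E) (pc := 58) (r := r) (h := h) (out := out)
      (t := 3) rfl (by omega) <| Reach.jumpLt_of_le rfl (by simp [h8, hs.down_zero]) <|
      Reach.output rfl (by simp [hr.lo]) <| Reach.jump rfl <| Reach.refl
    have e6 : Function.update r 9 (h (r 8 + 2)) 6 = r 6 := by simp
    have e7 : Function.update r 9 (h (r 8 + 2)) 7 = r 7 := by simp
    rw [e6, e7, hout] at R
    refine ⟨_, h, R, hs, hdyn, hr.congr fun i hi => ?_, ?_, fun _ _ _ => rfl, fun _ _ _ => rfl⟩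
    · simp [show i ≠ 9 by omega]
    · simp [h8]
  | succ j ih =>
    have hj' : j < n := hj
    have IH := ih hj'.le
    intro lists r h out hs hdyn hr h8 hlow hne hA hhd
    have h32 : 32 ≤ recAddr n (j + 1) := by unfold recAddr; omega
    have h0j : 0 < recAddr n j := by unfold recAddr; omega
    have hpos : 1 ≤ (lists (j + 1)).length := List.length_pos_iff.2 hne
    obtain ⟨r0, R0, e8, e9, e10, er⟩ : ∃ r0, Reach program E ⟨58, r, h, out⟩ 3
        ⟨63, r0, h, out⟩ ∧ r0 8 = recAddr n (j + 1) ∧ r0 9 = recAddr n j ∧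
        r0 10 = false.toNat ∧ ∀ i < 8, r0 i = r i := by
      refine ⟨_, Reach.load rfl (by omega) <| Reach.jumpLt_of_lt rfl
        (by simp [h8, hs.down j hj', hr.zero, h0j]) <| Reach.const rfl <| Reach.refl,
        ?_, ?_, ?_, ?_⟩
      · simp [h8]
      · simp [h8, hs.down j hj']
      · simp
      · intro i hi
        simp [show i ≠ 9 by omega, show i ≠ 10 by omega]
    obtain ⟨r1, h1, R1, hs1, hd1, hr1, f8, f9, f10, eb1, erec1⟩ := reach_branch (b := false)
      (out := out) hj' IH hs hdyn (hr.congr er) e8 e9 e10 hlow hne hA hhd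
    obtain ⟨r2, R2, g8, g9, g10, er2⟩ : ∃ r2, (∀ out, Reach program E ⟨81, r1, h1, out⟩ 3
        ⟨63, r2, h1, out⟩) ∧ r2 8 = recAddr n (j + 1) ∧ r2 9 = recAddr n j ∧
        r2 10 = true.toNat ∧ ∀ i < 8, r2 i = r1 i := by
      refine ⟨_, fun _ => Reach.jumpLt_of_le rfl (by simp [f10]) <| Reach.const rfl <|
        Reach.jump rfl <| Reach.refl, ?_, ?_, ?_, ?_⟩
      · simp [f8]
      · simp [f9]
      · simp
      · intro i hi
        simp [show i ≠ 10 by omega]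
    obtain ⟨r3, h3, R3, hs3, hd3, hr3, k8, k9, k10, eb3, erec3⟩ := reach_branch (b := true)
      (out := out ++ (if restrict false (lists (j + 1)) = [] then [] else
        (enum j (restrict false (lists (j + 1)))).map (false :: ·)).map (outWord n (j + 1) h))
      hj' IH hs1 hd1 (hr1.congr er2) g8 g9 g10 hlow hne hA (by rw [erec1 _ le_rfl hj, hhd])
    have hw : outWord n (j + 1) h1 = outWord n (j + 1) h := by
      funext v
      unfold outWord
      congr 1
      refine List.map_congr_left fun a ha => ?_
      have ha := List.mem_range'_1.1 ha
      have := eb1 (a - 32) (by omega) (by omega)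
      rwa [show 32 + (a - 32) = a by omega] at this
    refine ⟨r3, h3, ?_, hs3, hd3, hr3, k8, ?_, ?_⟩
    · rw [hw, List.append_assoc, ← List.map_append] at R3
      refine ((((R0.trans R1).trans (R2 _)).trans R3).trans (t' := 1) <|
        Reach.jumpLt_of_lt rfl ?_ <| Reach.refl).mono ?_
      · simp [hr3.zero, k10]
      · rw [cost]; omega
    · intro i hi hin; rw [eb3 i hi hin, eb1 i hi hin]
    · intro i hi hin; rw [erec3 i hi hin, erec1 i hi hin]

/-- The search from the highest level to the end of the program. -/
theorem reach_search (hs : Static n recs h) (hdyn : Dyn n recs h lists) (hr : Consts n r)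
    (h8 : r 8 = recAddr n n) (hlow : ∀ i < n, lists i = []) (hne : lists n ≠ [])
    (hA : IsStates recs n (lists n)) (hhd : h (recAddr n n) = hd n recs (lists n)) :
    ∃ r' h', Reach program E ⟨58, r, h, out⟩ (cost n (lists n) + (4 * (lists n).length + 4))
      ⟨98, r', h', out ++ (enum n (lists n)).map (fun v => v.reverse.map Bool.toNat)⟩ := by
  have h32 : 32 ≤ recAddr n n := by unfold recAddr; omega
  obtain ⟨r1, h1, R1, hs1, hd1, hr1, e8, -, erec⟩ := searches (E := E) n le_rfl lists r h out hs
    hdyn hr h8 hlow hne hA hhd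
  have hw : outWord n n h = fun v => v.reverse.map Bool.toNat := by
    funext v; simp [outWord]
  rw [hw] at R1
  have hhd1 := erec n le_rfl le_rfl
  rw [hhd] at hhd1
  obtain ⟨r2, h2, R2, hs2, -, er, -⟩ := reach_clear (E := E) (lists := lists)
    (out := out ++ (enum n (lists n)).map (fun v => v.reverse.map Bool.toNat))
    (lists n) (Function.update r1 12 (hd n recs (lists n))) h1 hne hA hs1 (by simpa using hd1)
    (by simp [hr1.zero]) (by simp [hr1.one]) (by simp)
  have R0 : ∀ out, Reach program E ⟨86, r1, h1, out⟩ 1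
      ⟨87, Function.update r1 12 (hd n recs (lists n)), h1, out⟩ := by
    intro out
    have := Reach.load (P := program) (E := E) (pc := 86) (r := r1) (h := h1) (out := out)
      (t := 0) rfl (by omega) Reach.refl
    simpa [e8, hhd1] using this
  refine ⟨_, h2, (((R1.trans (R0 _)).trans R2).trans (t' := 3) <| Reach.load rfl ?_ <|
    Reach.jumpLt_of_le rfl ?_ <| Reach.jump rfl Reach.refl).mono (by omega)⟩
  · rw [er 8 (by decide)]; simp [e8]; omega
  · simp [er 8 (by decide), e8, hs2.up_last]

end

/-! ### The precomputation -/

section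

variable {n : ℕ} {recs : List (List ℕ)} {E : Env} {r h : ℕ → ℕ} {out : List (List ℕ)}

/-- The number of variables is the number of letters `4`. -/
theorem reach_count (hκ : 2 * E.V + 1 ≤ E.κ) (hV : n < E.V) (hx : ∀ i < n, E.x.getD i 0 = 4)
    (hxn : E.x.getD n 0 < 4) (k : ℕ) : ∀ (i : ℕ) (r : ℕ → ℕ), i + k = n → r 5 = i → r 1 = 1 →
    r 4 = 4 →
    ∃ r', Reach program E ⟨5, r, h, out⟩ (4 * k + 2) ⟨9, r', h, out⟩ ∧ r' 5 = n ∧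
      ∀ i, i ≠ 5 → i ≠ 16 → r' i = r i := by
  induction k with
  | zero =>
    intro i r hi h5 h1 h4
    refine ⟨_, Reach.input rfl <| Reach.jumpLt_of_lt rfl ?_ <| Reach.refl, ?_, ?_⟩
    · simp only [Function.update_self, h5]
      rw [Function.update_of_ne (by decide), h4, show i = n by omega]
      exact hxn
    · simp [h5]; omega
    · intro i h5 h16; simp [h16]
  | succ k ih =>
    intro i r hi h5 h1 h4
    obtain ⟨r', R, e5, er⟩ := ih (i + 1) (Function.update (Function.update r 16 4) 5 (i + 1))
      (by omega) (by simp) (by simp [h1]) (by simp [h4])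
    refine ⟨r', ?_, e5, ?_⟩
    · have e : Function.update (Function.update r 16 (E.x.getD (r 5) 0)) 5
          (Function.update r 16 (E.x.getD (r 5) 0) 5 +
            Function.update r 16 (E.x.getD (r 5) 0) 1) =
          Function.update (Function.update r 16 4) 5 (i + 1) := by
        rw [Function.update_of_ne (by decide), Function.update_of_ne (by decide), h5, h1,
          hx i (by omega)]
      refine (Reach.input (t := 4 * k + 2 + 3) rfl <| Reach.jumpLt_of_le rfl ?_ <|
        Reach.add rfl hκ ?_ <| Reach.jump rfl ?_).mono (by omega)
      · simp only [Function.update_self, h5, hx i (by omega)]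
        rw [Function.update_of_ne (by decide), h4]
      · rw [Function.update_of_ne (by decide), Function.update_of_ne (by decide), h5, h1]
        omega
      · rw [e]; exact R
    · intro i h5 h16
      rw [er i h5 h16]
      simp [h5, h16]

/-- The levels up to `j` are built, except for the link of level `j` to a higher level. -/
structure Levels (n j : ℕ) (h : ℕ → ℕ) : Prop where
  bit : ∀ i < j, h (recAddr n (i + 1) + 1) = 32 + i
  down_zero : h (recAddr n 0 + 2) = 0
  down : ∀ i < j, h (recAddr n (i + 1) + 2) = recAddr n i
  up : ∀ i < j, h (recAddr n i + 3) = recAddr n (i + 1)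
  zero : ∀ a, recAddr n j + 3 ≤ a → h a = 0

/-- The levels above level `j` are built; `k + 1` of them are missing. -/
theorem reach_levels (hκ : 2 * E.V + 1 ≤ E.κ) (hV : recAddr n (n + 1) ≤ E.V) (k : ℕ) :
    ∀ (j : ℕ) (r h : ℕ → ℕ), j + k + 1 = n → Levels n j h → r 8 = recAddr n j → r 11 = 32 + j →
    r 7 = 32 + n → r 4 = 4 → r 1 = 1 →
    ∃ r' h', Reach program E ⟨12, r, h, out⟩ (7 * (k + 1)) ⟨19, r', h', out⟩ ∧ Levels n n h' ∧
      r' 8 = recAddr n n ∧ ∀ i, i ≠ 8 → i ≠ 11 → i ≠ 24 → r' i = r i := by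
  induction k with
  | zero => ?_
  | succ k ih => ?_
  all_goals
    intro j r h hj hl h8 h11 h7 h4 h1
    have e24 : recAddr n j + 4 = recAddr n (j + 1) := by unfold recAddr; ring
    have hle : recAddr n (j + 1) ≤ recAddr n (n + 1) := by unfold recAddr; omega
    obtain ⟨r1, R, e8, e11, er⟩ : ∃ r1, Reach program E ⟨12, r, h, out⟩ 6
        ⟨18, r1, Function.update (Function.update (Function.update h (recAddr n j + 3)
          (recAddr n (j + 1))) (recAddr n (j + 1) + 2) (recAddr n j))
          (recAddr n (j + 1) + 1) (32 + j), out⟩ ∧ r1 8 = recAddr n (j + 1) ∧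
        r1 11 = 32 + (j + 1) ∧ ∀ i, i ≠ 8 → i ≠ 11 → i ≠ 24 → r1 i = r i := by
      have := Reach.add (P := program) (E := E) (pc := 12) (r := r) (h := h) (out := out)
        (t := 5) rfl hκ (by omega) <|
        Reach.store rfl (by simp [h8]; unfold recAddr; omega) <|
        Reach.store rfl (by simp [h8]; unfold recAddr; omega) <|
        Reach.store rfl (by simp [h8]; unfold recAddr; omega) <| Reach.copy rfl <|
        Reach.add rfl hκ (by simp [h11, h1]; unfold recAddr at hV; omega) <| Reach.refl
      simp [h8, h4, h11, h1, e24] at this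
      refine ⟨_, this, by simp, by simp; omega, fun i h8 h11 h24 => by simp [h8, h11, h24]⟩
    set h1' := Function.update (Function.update (Function.update h (recAddr n j + 3)
          (recAddr n (j + 1))) (recAddr n (j + 1) + 2) (recAddr n j))
          (recAddr n (j + 1) + 1) (32 + j)
    have hl1 : Levels n (j + 1) h1' := by
      have hold : ∀ i ≤ j, ∀ d < 4, d ≠ 3 → h1' (recAddr n i + d) = h (recAddr n i + d) := by
        intro i hi d hd hd'
        refine (Function.update_of_ne ?_ _ _).trans <| (Function.update_of_ne ?_ _ _).trans <|
          Function.update_of_ne ?_ _ _ <;> unfold recAddr <;> omega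
      have hold3 : ∀ i < j, h1' (recAddr n i + 3) = h (recAddr n i + 3) := by
        intro i hi
        refine (Function.update_of_ne ?_ _ _).trans <| (Function.update_of_ne ?_ _ _).trans <|
          Function.update_of_ne ?_ _ _ <;> unfold recAddr <;> omega
      constructor
      · intro i hi
        rcases Nat.lt_succ_iff_lt_or_eq.1 hi with hi | rfl
        · rw [hold (i + 1) hi _ (by decide) (by decide), hl.bit i hi]
        · exact Function.update_self ..
      · rw [hold 0 (Nat.zero_le _) _ (by decide) (by decide), hl.down_zero]
      · intro i hi
        rcases Nat.lt_succ_iff_lt_or_eq.1 hi with hi | rfl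
        · rw [hold (i + 1) hi _ (by decide) (by decide), hl.down i hi]
        · exact (Function.update_of_ne (by simp) _ _).trans (Function.update_self ..)
      · intro i hi
        rcases Nat.lt_succ_iff_lt_or_eq.1 hi with hi | rfl
        · rw [hold3 i hi, hl.up i hi]
        · refine (Function.update_of_ne ?_ _ _).trans <| (Function.update_of_ne ?_ _ _).trans <|
            Function.update_self .. <;> unfold recAddr <;> omega
      · intro a ha
        refine (Function.update_of_ne ?_ _ _).trans <| (Function.update_of_ne ?_ _ _).trans <|
          (Function.update_of_ne ?_ _ _).trans <| hl.zero a ?_ <;> unfold recAddr at * <;> omega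
  · have hn : j + 1 = n := by omega
    rw [hn] at hl1 e8 e11
    refine ⟨r1, h1', R.trans (t' := 1) <| Reach.jumpLt_of_le rfl ?_ <| Reach.refl, hl1, e8, er⟩
    rw [e11, er 7 (by decide) (by decide) (by decide), h7]
  · obtain ⟨r2, h2, R2, hl2, e8', er'⟩ := ih (j + 1) r1 h1' (by omega) hl1 e8 e11
      (by rw [er 7 (by decide) (by decide) (by decide), h7])
      (by rw [er 4 (by decide) (by decide) (by decide), h4])
      (by rw [er 1 (by decide) (by decide) (by decide), h1])
    refine ⟨r2, h2, (R.trans <| Reach.jumpLt_of_lt rfl ?_ R2).mono (by omega), hl2, e8', ?_⟩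
    · rw [e11, er 7 (by decide) (by decide) (by decide), h7]; omega
    · intro i a b c; rw [er' i a b c, er i a b c]

/-- The address of the restriction of the word `w` to the value `b`, or `0` if there is none. -/
def fld (n : ℕ) (recs : List (List ℕ)) (b : Bool) : List ℕ → ℕ
  | [] => 0
  | ℓ :: u => if allows ℓ b = true then ad n recs u else 0

/-- The heap after the records for the words `recs` have been built and the words `lst` have been
linked to a list. -/
structure PreHeap (n : ℕ) (recs lst : List (List ℕ)) (h : ℕ → ℕ) : Prop where
  bit : ∀ j < n, h (recAddr n (j + 1) + 1) = 32 + j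
  down_zero : h (recAddr n 0 + 2) = 0
  down : ∀ j < n, h (recAddr n (j + 1) + 2) = recAddr n j
  up : ∀ j < n, h (recAddr n j + 3) = recAddr n (j + 1)
  up_last : h (recAddr n n + 3) = 0
  head : recs.head? = some []
  tail_mem : ∀ ℓ u, ℓ :: u ∈ recs → u ∈ recs
  letters : ∀ w ∈ recs, ∀ ℓ ∈ w, 1 ≤ ℓ ∧ ℓ ≤ 3
  lst_mem : ∀ w ∈ lst, w ∈ recs
  field_false : ∀ k (hk : k < recs.length),
    h (recAddr n (n + 1 + k) + 1) = fld n recs false recs[k]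
  field_true : ∀ k (hk : k < recs.length),
    h (recAddr n (n + 1 + k) + 2) = fld n recs true recs[k]
  next : ∀ u ∈ recs, h (ad n recs u) = link n recs lst u
  zero : ∀ a, recAddr n (n + 1 + recs.length) ≤ a → h a = 0

variable {lst : List (List ℕ)}

theorem PreHeap.nil_mem (hp : PreHeap n recs lst h) : [] ∈ recs := by
  have := hp.head
  cases recs with
  | nil => simp at this
  | cons w l => simp at this; simp [this]

theorem PreHeap.ad_nil (hp : PreHeap n recs lst h) : ad n recs [] = recAddr n (n + 1) := by
  have := hp.head
  cases recs with
  | nil => simp at this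
  | cons w l => simp at this; simp [this, ad]

theorem ad_append {u w : List ℕ} (hu : u ∈ recs) : ad n (recs ++ [w]) u = ad n recs u := by
  rw [ad, ad, List.idxOf_append_of_mem hu]

/-- Appending a record does not move the states that have one already. -/
theorem hd_append {w : List ℕ} {l : List (List ℕ)} (hl : ∀ u ∈ l, u ∈ recs) :
    hd n (recs ++ [w]) l = hd n recs l := by
  cases l with
  | nil => rfl
  | cons v l => exact ad_append (hl v (by simp))

theorem link_append_right {w u : List ℕ} {l : List (List ℕ)} (hl : ∀ u ∈ l, u ∈ recs) :
    link n (recs ++ [w]) l u = link n recs l u := by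
  induction l with
  | nil => rfl
  | cons v l ih =>
    have hl' : ∀ u ∈ l, u ∈ recs := fun u hu => hl u (by simp [hu])
    rw [link, link, hd_append hl', ih hl']

theorem fld_append {w v : List ℕ} {b : Bool} (hv : ∀ ℓ u, v = ℓ :: u → u ∈ recs) :
    fld n (recs ++ [w]) b v = fld n recs b v := by
  cases v with
  | nil => rfl
  | cons ℓ u => rw [fld, fld, ad_append (hv ℓ u rfl)]

/-- Both restrictions together determine a word. -/
theorem fld_inj {w : List ℕ} {ℓ : ℕ} {u : List ℕ} (hu : u ∈ recs) (hℓ : 1 ≤ ℓ ∧ ℓ ≤ 3)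
    (hw : ∀ ℓ ∈ w, 1 ≤ ℓ ∧ ℓ ≤ 3) (h1 : fld n recs false w = fld n recs false (ℓ :: u))
    (h2 : fld n recs true w = fld n recs true (ℓ :: u)) : w = ℓ :: u := by
  have had : ∀ v, 0 < ad n recs v := fun v => by unfold ad recAddr; omega
  have hau := had u
  cases w with
  | nil =>
    have : ℓ = 1 ∨ ℓ = 2 ∨ ℓ = 3 := by omega
    rcases this with rfl | rfl | rfl <;> simp [fld, allows] at h1 h2 <;> omega
  | cons k v =>
    have hav := had v
    have hk := hw k (by simp)
    have hk' : k = 1 ∨ k = 2 ∨ k = 3 := by omega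
    have hℓ' : ℓ = 1 ∨ ℓ = 2 ∨ ℓ = 3 := by omega
    have inj : ad n recs v = ad n recs u → v = u := fun e => (ad_inj hu e.symm).symm
    rcases hk' with rfl | rfl | rfl <;> rcases hℓ' with rfl | rfl | rfl <;>
      simp [fld, allows] at h1 h2 ⊢ <;> first | omega | exact inj h1 | exact inj h2

/-- The registers that are constant while the states are built. -/
structure PreConsts (n : ℕ) (r : ℕ → ℕ) : Prop extends Consts n r where
  two : r 2 = 2
  three : r 3 = 3
  four : r 4 = 4
  vars : r 5 = n
  top : r 8 = recAddr n n
  empty : r 22 = recAddr n (n + 1)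

theorem PreConsts.congr {r r' : ℕ → ℕ} (hr : PreConsts n r)
    (hrr : ∀ i, i < 9 ∨ i = 22 → r' i = r i) : PreConsts n r' :=
  ⟨hr.toConsts.congr fun i hi => hrr i (by omega), by rw [hrr 2 (by decide), hr.two],
    by rw [hrr 3 (by decide), hr.three], by rw [hrr 4 (by decide), hr.four],
    by rw [hrr 5 (by decide), hr.vars], by rw [hrr 8 (by decide), hr.top],
    by rw [hrr 22 (by decide), hr.empty]⟩

theorem PreHeap.append (hp : PreHeap n recs lst h) {ℓ : ℕ} {u : List ℕ} (hu : u ∈ recs)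
    (hℓ : 1 ≤ ℓ ∧ ℓ ≤ 3) {h' : ℕ → ℕ}
    (hold : ∀ a, a ≠ recAddr n (n + 1 + recs.length) + 1 →
      a ≠ recAddr n (n + 1 + recs.length) + 2 → h' a = h a)
    (h1 : h' (recAddr n (n + 1 + recs.length) + 1) = fld n recs false (ℓ :: u))
    (h2 : h' (recAddr n (n + 1 + recs.length) + 2) = fld n recs true (ℓ :: u)) :
    PreHeap n (recs ++ [ℓ :: u]) lst h' := by
  have hold' : ∀ k < n + 1 + recs.length, ∀ d < 4, h' (recAddr n k + d) = h (recAddr n k + d) := by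
    intro k hk d hd
    refine hold _ ?_ ?_ <;> unfold recAddr <;> omega
  have htail : ∀ w ∈ recs ++ [ℓ :: u], ∀ k v, w = k :: v → v ∈ recs := by
    intro w hw k v e
    rcases List.mem_append.1 hw with hw | hw
    · exact hp.tail_mem k v (e ▸ hw)
    · simp only [List.mem_singleton] at hw
      rw [hw] at e
      simp only [List.cons.injEq] at e
      exact e.2 ▸ hu
  have hfld : ∀ b (k : ℕ) (hk : k < (recs ++ [ℓ :: u]).length),
      fld n (recs ++ [ℓ :: u]) b (recs ++ [ℓ :: u])[k] = fld n recs b (recs ++ [ℓ :: u])[k] :=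
    fun b k hk => fld_append (fun k' v e => htail _ (List.getElem_mem hk) k' v e)
  constructor
  · intro j hj; rw [hold' _ (by omega) _ (by decide), hp.bit j hj]
  · rw [hold' _ (by omega) _ (by decide), hp.down_zero]
  · intro j hj; rw [hold' _ (by omega) _ (by decide), hp.down j hj]
  · intro j hj; rw [hold' _ (by omega) _ (by decide), hp.up j hj]
  · rw [hold' _ (by omega) _ (by decide), hp.up_last]
  · rw [List.head?_append, hp.head]; rfl
  · intro k v hv
    exact List.mem_append_left _ (htail _ hv k v rfl)
  · intro w hw k hk
    rcases List.mem_append.1 hw with hw | hw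
    · exact hp.letters w hw k hk
    · simp only [List.mem_singleton] at hw
      rw [hw, List.mem_cons] at hk
      rcases hk with rfl | hk
      · exact hℓ
      · exact hp.letters u hu k hk
  · exact fun w hw => List.mem_append_left _ (hp.lst_mem w hw)
  · intro k hk
    rw [hfld]
    by_cases hk' : k < recs.length
    · rw [hold' _ (by omega) _ (by decide), hp.field_false k hk', List.getElem_append_left hk']
    · have : k = recs.length := by simp at hk; omega
      subst this
      rw [h1]; simp
  · intro k hk
    rw [hfld]
    by_cases hk' : k < recs.length
    · rw [hold' _ (by omega) _ (by decide), hp.field_true k hk', List.getElem_append_left hk']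
    · have : k = recs.length := by simp at hk; omega
      subst this
      rw [h2]; simp
  · intro v hv
    rw [link_append_right hp.lst_mem]
    by_cases hvr : v ∈ recs
    · have := List.idxOf_lt_length_of_mem hvr
      rw [ad_append hvr, ← hp.next v hvr]
      exact hold' _ (by omega) 0 (by decide)
    · have e : v = ℓ :: u := by simpa [hvr] using hv
      rw [link_of_not_mem (fun hm => hvr (hp.lst_mem v hm))]
      have had : ad n (recs ++ [ℓ :: u]) v = recAddr n (n + 1 + recs.length) := by
        rw [ad, List.idxOf_append_of_notMem hvr, e]; simp
      rw [had, hold _ (by omega) (by omega)]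
      exact hp.zero _ le_rfl
  · intro a ha
    simp only [List.length_append, List.length_singleton] at ha
    rw [hold _ (by unfold recAddr at *; omega) (by unfold recAddr at *; omega)]
    exact hp.zero a (by unfold recAddr at *; omega)

/-- The search for the first record of the word `ℓ :: u`. -/
theorem reach_find (hκ : 2 * E.V + 1 ≤ E.κ) (hp : PreHeap n recs lst h) {ℓ : ℕ} {u : List ℕ}
    (hmem : ℓ :: u ∈ recs) (hV : recAddr n (n + 1 + recs.length) ≤ E.V) (d : ℕ) :
    ∀ (k : ℕ) (r : ℕ → ℕ), k + d = recs.idxOf (ℓ :: u) → r 20 = recAddr n (n + 1 + k) →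
    r 14 = fld n recs false (ℓ :: u) → r 19 = fld n recs true (ℓ :: u) → r 4 = 4 →
    ∃ r', Reach program E ⟨36, r, h, out⟩ (8 * (d + 1)) ⟨45, r', h, out⟩ ∧
      r' 20 = ad n recs (ℓ :: u) ∧ ∀ i, i ≠ 20 → i ≠ 21 → r' i = r i := by
  have hlt := List.idxOf_lt_length_of_mem hmem
  have h32 : ∀ k, 32 ≤ recAddr n k := fun k => by unfold recAddr; omega
  induction d with
  | zero =>
    intro k r hk h20 h14 h19 h4
    have hk' : k < recs.length := by omega
    have e : recs[k] = ℓ :: u := by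
      have := List.getElem_idxOf hlt
      simp only [← hk, Nat.add_zero] at this
      exact this
    have e1 := hp.field_false k hk'
    have e2 := hp.field_true k hk'
    rw [e] at e1 e2
    have h32k := h32 (n + 1 + k)
    refine ⟨_, Reach.load rfl ?_ <| Reach.jumpLt_of_le rfl ?_ <| Reach.jumpLt_of_le rfl ?_ <|
      Reach.load rfl ?_ <| Reach.jumpLt_of_le rfl ?_ <| Reach.jumpLt_of_le rfl ?_ <|
      Reach.jump rfl <| Reach.refl, ?_, ?_⟩
    · omega
    · simp [h20, e1, h14]
    · simp [h20, e1, h14]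
    · simp; omega
    · simp [h20, e2, h19]
    · simp [h20, e2, h19]
    · simp [h20, ad, ← hk]
    · intro i h20 h21; simp [h21]
  | succ d ih =>
    intro k r hk h20 h14 h19 h4
    have hk' : k < recs.length := by omega
    have hne : recs[k] ≠ ℓ :: u := by
      intro e
      have hlt : k < recs.findIdx (· == ℓ :: u) := by
        change k < recs.idxOf (ℓ :: u)
        omega
      simpa [e] using List.not_of_lt_findIdx hlt
    have e1 := hp.field_false k hk'
    have e2 := hp.field_true k hk'
    have h32k := h32 (n + 1 + k)
    have hfld : fld n recs false recs[k] ≠ fld n recs false (ℓ :: u) ∨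
        fld n recs true recs[k] ≠ fld n recs true (ℓ :: u) := by
      by_contra hcon
      push Not at hcon
      exact hne (fld_inj (hp.tail_mem ℓ u hmem) (hp.letters _ hmem ℓ (by simp))
        (hp.letters _ (List.getElem_mem hk')) hcon.1 hcon.2)
    obtain ⟨r1, R, er⟩ : ∃ r1, Reach program E ⟨36, r, h, out⟩ 6 ⟨43, r1, h, out⟩ ∧
        ∀ i, i ≠ 21 → r1 i = r i := by
      by_cases hf : fld n recs false recs[k] = fld n recs false (ℓ :: u)
      · have hf2 := hfld.resolve_left (not_not.2 hf)
        rcases lt_or_gt_of_ne hf2 with hl | hl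
        · refine ⟨_, Reach.load rfl ?_ <| Reach.jumpLt_of_le rfl ?_ <|
            Reach.jumpLt_of_le rfl ?_ <| Reach.load rfl ?_ <| Reach.jumpLt_of_lt rfl ?_ <|
            Reach.refl, ?_⟩
          · omega
          · simp [h20, e1, h14, hf]
          · simp [h20, e1, h14, hf]
          · simp; omega
          · simpa [h20, e2, h19] using hl
          · intro i h21; simp [h21]
        · refine ⟨_, Reach.load rfl ?_ <| Reach.jumpLt_of_le rfl ?_ <|
            Reach.jumpLt_of_le rfl ?_ <| Reach.load rfl ?_ <| Reach.jumpLt_of_le rfl ?_ <|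
            Reach.jumpLt_of_lt rfl ?_ <| Reach.refl, ?_⟩
          · omega
          · simp [h20, e1, h14, hf]
          · simp [h20, e1, h14, hf]
          · simp; omega
          · simpa [h20, e2, h19] using hl.le
          · simpa [h20, e2, h19] using hl
          · intro i h21; simp [h21]
      · rcases lt_or_gt_of_ne hf with hl | hl
        · refine ⟨_, Reach.load rfl ?_ <| Reach.jumpLt_of_lt rfl ?_ <| Reach.refl, ?_⟩
          · omega
          · simpa [h20, e1, h14] using hl
          · intro i h21; simp [h21]
        · refine ⟨_, Reach.load rfl ?_ <| Reach.jumpLt_of_le rfl ?_ <|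
            Reach.jumpLt_of_lt rfl ?_ <| Reach.refl, ?_⟩
          · omega
          · simpa [h20, e1, h14] using hl.le
          · simpa [h20, e1, h14] using hl
          · intro i h21; simp [h21]
    have e20 : r1 20 = recAddr n (n + 1 + k) := by rw [er 20 (by decide), h20]
    have e4 : r1 4 = 4 := by rw [er 4 (by decide), h4]
    have enext : recAddr n (n + 1 + k) + 4 = recAddr n (n + 1 + (k + 1)) := by
      unfold recAddr; ring
    obtain ⟨r2, R2, f20, er2⟩ := ih (k + 1) (Function.update r1 20 (r1 20 + r1 4)) (by omega)
      (by simp [e20, e4, enext]) (by simp [er, h14]) (by simp [er, h19]) (by simp [e4])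
    refine ⟨r2, (R.trans <| Reach.add rfl hκ ?_ <| Reach.jump rfl R2).mono (by omega), f20, ?_⟩
    · rw [e20, e4, enext]
      exact le_trans (by unfold recAddr; omega) hV
    · intro i h20 h21
      rw [er2 i h20 h21]
      simp [h20, er i h21]

/-- From the position `pos` on the input consists of the letters `l`. -/
def InputAt (E : Env) (pos : ℕ) (l : List ℕ) : Prop :=
  ∀ i, E.x.getD (pos + i) 0 = l.getD i 0

theorem InputAt.head {pos ℓ : ℕ} {l : List ℕ} (hi : InputAt E pos (ℓ :: l)) :
    E.x.getD pos 0 = ℓ := by simpa using hi 0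

theorem InputAt.tail {pos ℓ : ℕ} {l : List ℕ} (hi : InputAt E pos (ℓ :: l)) :
    InputAt E (pos + 1) l := by
  intro i
  have := hi (i + 1)
  rw [show pos + 1 + i = pos + (i + 1) by ring, this]
  simp

/-- The record for one more letter of a term is built. -/
theorem reach_letter (hκ : 2 * E.V + 1 ≤ E.κ) (hp : PreHeap n recs lst h) (hr : PreConsts n r)
    {ℓ : ℕ} {u rest : List ℕ} (hu : u ∈ recs) (hun : u.length < n) (hℓ : 1 ≤ ℓ ∧ ℓ ≤ 3)
    {pos : ℕ} (hi : InputAt E pos (ℓ :: rest)) (hpos : pos < E.V)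
    (hV : recAddr n (n + 1 + (recs.length + 1)) ≤ E.V)
    (h13 : r 13 = ad n recs u) (h17 : r 17 = pos) (h18 : r 18 = u.length)
    (h23 : r 23 = recAddr n (n + 1 + recs.length)) :
    ∃ r' h', Reach program E ⟨26, r, h, out⟩ (8 * (recs.length + 1) + 13) ⟨49, r', h', out⟩ ∧
      PreHeap n (recs ++ [ℓ :: u]) lst h' ∧ PreConsts n r' ∧
      r' 13 = ad n (recs ++ [ℓ :: u]) (ℓ :: u) ∧ r' 17 = pos + 1 ∧ r' 18 = u.length + 1 ∧
      r' 23 = recAddr n (n + 1 + (recs.length + 1)) ∧ r' 15 = r 15 := by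
  have h32 : 32 ≤ recAddr n (n + 1 + recs.length) := by unfold recAddr; omega
  have hx := hi.head
  rw [List.getD_eq_getElem?_getD] at hx
  have hz1 : h (recAddr n (n + 1 + recs.length) + 1) = 0 := hp.zero _ (by omega)
  have hz2 : h (recAddr n (n + 1 + recs.length) + 2) = 0 := hp.zero _ (by omega)
  -- the fields of the new record are written
  obtain ⟨r1, h1, R1, er1, hold, f1, f2⟩ : ∃ r1 h1, Reach program E ⟨26, r, h, out⟩ 6
      ⟨33, r1, h1, out⟩ ∧ (∀ i, i ≠ 16 → r1 i = r i) ∧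
      (∀ a, a ≠ recAddr n (n + 1 + recs.length) + 1 →
        a ≠ recAddr n (n + 1 + recs.length) + 2 → h1 a = h a) ∧
      h1 (recAddr n (n + 1 + recs.length) + 1) = fld n recs false (ℓ :: u) ∧
      h1 (recAddr n (n + 1 + recs.length) + 2) = fld n recs true (ℓ :: u) := by
    have hℓ' : ℓ = 1 ∨ ℓ = 2 ∨ ℓ = 3 := by omega
    rcases hℓ' with rfl | rfl | rfl
    · refine ⟨_, _, Reach.input rfl <| Reach.jumpLt_of_lt rfl ?_ <| Reach.jumpLt_of_lt rfl ?_ <|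
        Reach.store rfl ?_ <| Reach.refl, ?_, ?_, ?_, ?_⟩
      · simp [h17, hx, hr.zero]
      · simp [h17, hx, hr.two]
      · simp [h23]; omega
      · intro i hi; simp [hi]
      · intro a h1 h2; simp [h23, h1]
      · simp [h23, h13, fld, allows]
      · simp [h23, fld, allows, hz2]
    · refine ⟨_, _, Reach.input rfl <| Reach.jumpLt_of_lt rfl ?_ <| Reach.jumpLt_of_le rfl ?_ <|
        Reach.store rfl ?_ <| Reach.jumpLt_of_lt rfl ?_ <| Reach.refl, ?_, ?_, ?_, ?_⟩
      · simp [h17, hx, hr.zero]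
      · simp [h17, hx, hr.two]
      · simp [h23]; omega
      · simp [h17, hx, hr.three]
      · intro i hi; simp [hi]
      · intro a h1 h2; simp [h23, h2]
      · simp [h23, fld, allows, hz1]
      · simp [h23, h13, fld, allows]
    · refine ⟨_, _, Reach.input rfl <| Reach.jumpLt_of_lt rfl ?_ <| Reach.jumpLt_of_le rfl ?_ <|
        Reach.store rfl ?_ <| Reach.jumpLt_of_le rfl ?_ <| Reach.store rfl ?_ <| Reach.refl,
        ?_, ?_, ?_, ?_⟩
      · simp [h17, hx, hr.zero]
      · simp [h17, hx, hr.two]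
      · simp [h23]; omega
      · simp [h17, hx, hr.three]
      · simp [h23]; omega
      · intro i hi; simp [hi]
      · intro a h1 h2; simp [h23, h1, h2]
      · simp [h23, h13, fld, allows]
      · simp [h23, h13, fld, allows]
  have hp1 : PreHeap n (recs ++ [ℓ :: u]) lst h1 := hp.append hu hℓ hold f1 f2
  have hmem : ℓ :: u ∈ recs ++ [ℓ :: u] := by simp
  have hlen : (recs ++ [ℓ :: u]).length = recs.length + 1 := by simp
  have hidx : (recs ++ [ℓ :: u]).idxOf (ℓ :: u) < recs.length + 1 := by
    rw [← hlen]; exact List.idxOf_lt_length_of_mem hmem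
  have hr1 : PreConsts n r1 := hr.congr fun i hi => er1 i (by omega)
  have g1 : fld n (recs ++ [ℓ :: u]) false (ℓ :: u) = fld n recs false (ℓ :: u) :=
    fld_append fun k v e => by
      simp only [List.cons.injEq] at e
      exact e.2 ▸ hu
  have g2 : fld n (recs ++ [ℓ :: u]) true (ℓ :: u) = fld n recs true (ℓ :: u) :=
    fld_append fun k v e => by
      simp only [List.cons.injEq] at e
      exact e.2 ▸ hu
  have e22 : r1 22 = recAddr n (n + 1) := hr1.empty
  have e23 : r1 23 = recAddr n (n + 1 + recs.length) := by rw [er1 23 (by decide), h23]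
  obtain ⟨r2, R2, e20, e14, e19, er2⟩ : ∃ r2, Reach program E ⟨33, r1, h1, out⟩ 3
      ⟨36, r2, h1, out⟩ ∧ r2 20 = recAddr n (n + 1 + 0) ∧
      r2 14 = fld n (recs ++ [ℓ :: u]) false (ℓ :: u) ∧
      r2 19 = fld n (recs ++ [ℓ :: u]) true (ℓ :: u) ∧
      ∀ i, i ≠ 14 → i ≠ 19 → i ≠ 20 → r2 i = r1 i := by
    refine ⟨_, Reach.load rfl ?_ <| Reach.load rfl ?_ <| Reach.copy rfl <| Reach.refl,
      ?_, ?_, ?_, ?_⟩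
    · omega
    · simp; omega
    · simp [e22]
    · simp [e23, f1, g1]
    · simp [e23, f2, g2]
    · intro i a b c; simp [a, b, c]
  have e4 : r2 4 = 4 := by rw [er2 4 (by decide) (by decide) (by decide), hr1.four]
  obtain ⟨r3, R3, e20', er3⟩ := reach_find (out := out) hκ hp1 hmem (by rw [hlen]; exact hV)
    ((recs ++ [ℓ :: u]).idxOf (ℓ :: u)) 0 r2 (by simp) e20 e14 e19 e4
  have er : ∀ i, i ∉ [14, 16, 19, 20, 21] → r3 i = r i := by
    intro i hi
    simp only [List.mem_cons, List.not_mem_nil, not_or, or_false] at hi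
    rw [er3 i (by omega) (by omega), er2 i (by omega) (by omega) (by omega), er1 i (by omega)]
  have k1 : r3 1 = 1 := by rw [er 1 (by decide), hr.one]
  have k4 : r3 4 = 4 := by rw [er 4 (by decide), hr.four]
  have k17 : r3 17 = pos := by rw [er 17 (by decide), h17]
  have k18 : r3 18 = u.length := by rw [er 18 (by decide), h18]
  have k23 : r3 23 = recAddr n (n + 1 + recs.length) := by rw [er 23 (by decide), h23]
  have hrr : recAddr n (n + 1 + recs.length) + 4 = recAddr n (n + 1 + (recs.length + 1)) := by
    unfold recAddr; ring
  refine ⟨_, h1, (((R1.trans R2).trans R3).trans (t' := 4) <| Reach.copy rfl <|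
    Reach.add rfl hκ ?_ <| Reach.add rfl hκ ?_ <| Reach.add rfl hκ ?_ <| Reach.refl).mono ?_,
    hp1, ?_, ?_, ?_, ?_, ?_, ?_⟩
  · simp [k23, k4, hrr, hV]
  · simp [k17, k1]; omega
  · simp [k18, k1]; unfold recAddr at hV; omega
  · omega
  · refine hr.congr fun i hi => ?_
    have a1 : i ≠ 13 := by omega
    have a2 : i ≠ 17 := by omega
    have a3 : i ≠ 18 := by omega
    have a4 : i ≠ 23 := by omega
    simp only [ne_eq, a1, a2, a3, a4, not_false_eq_true, Function.update_of_ne]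
    exact er i (by simp; omega)
  · simp [e20']
  · simp [k17, k1]
  · simp [k18, k1]
  · simp [k23, k4, hrr]
  · simp [er 15 (by decide)]

/-- The records for the letters `rem`, the last ones of a term, are built. -/
theorem reach_letters (hκ : 2 * E.V + 1 ≤ E.κ) {K : ℕ} (hV : recAddr n (n + 1 + K) ≤ E.V)
    (rem : List ℕ) : ∀ (recs : List (List ℕ)) (u rest : List ℕ) (pos : ℕ) (r h : ℕ → ℕ),
    rem ≠ [] → PreHeap n recs lst h → PreConsts n r → u ∈ recs → u.length + rem.length = n →
    (∀ ℓ ∈ rem, 1 ≤ ℓ ∧ ℓ ≤ 3) → InputAt E pos (rem ++ rest) →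
    recs.length + rem.length ≤ K → pos + rem.length ≤ E.V →
    r 13 = ad n recs u → r 17 = pos → r 18 = u.length →
    r 23 = recAddr n (n + 1 + recs.length) → r 15 = hd n recs lst →
    ∃ r' h' recs', Reach program E ⟨26, r, h, out⟩ (rem.length * (8 * K + 14))
        ⟨50, r', h', out⟩ ∧
      PreHeap n recs' lst h' ∧ PreConsts n r' ∧ rem.reverse ++ u ∈ recs' ∧
      recs'.length = recs.length + rem.length ∧ InputAt E (pos + rem.length) rest ∧
      r' 13 = ad n recs' (rem.reverse ++ u) ∧ r' 17 = pos + rem.length ∧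
      r' 23 = recAddr n (n + 1 + recs'.length) ∧ r' 15 = hd n recs' lst := by
  induction rem with
  | nil => intro _ _ _ _ _ _ h; exact absurd rfl h
  | cons ℓ rem ih =>
    intro recs u rest pos r h _ hp hr hu hlen hlet hi hK hpos h13 h17 h18 h23 h15
    simp only [List.length_cons] at hlen hK hpos
    have hadd : recAddr n (n + 1 + (recs.length + 1)) ≤ E.V :=
      le_trans (by unfold recAddr; omega) hV
    obtain ⟨r1, h1, R1, hp1, hr1, e13, e17, e18, e23, e15⟩ := reach_letter (out := out) hκ hp hr
      hu (by omega) (hlet ℓ (by simp)) hi (by omega) hadd h13 h17 h18 h23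
    have e15' : r1 15 = hd n (recs ++ [ℓ :: u]) lst := by rw [e15, h15, hd_append hp.lst_mem]
    have hlen1 : (recs ++ [ℓ :: u]).length = recs.length + 1 := by simp
    have htime : 8 * (recs.length + 1) + 13 + 1 ≤ 8 * K + 14 := by omega
    by_cases hrem : rem = []
    · subst hrem
      refine ⟨r1, h1, recs ++ [ℓ :: u], (R1.trans (t' := 1) <| Reach.jumpLt_of_le rfl ?_ <|
        Reach.refl).mono (by simpa using htime), hp1, hr1, by simp, by simp,
        by simpa using hi.tail, by simpa using e13, by simpa using e17, by rw [hlen1, e23], e15'⟩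
      rw [hr1.vars, e18]
      simp at hlen
      omega
    · have hrpos := List.length_pos_iff.2 hrem
      obtain ⟨r2, h2, recs', R2, hp2, hr2, hmem, hlen2, hi2, f13, f17, f23, f15⟩ :=
        ih (recs ++ [ℓ :: u]) (ℓ :: u) rest (pos + 1) r1 h1 hrem hp1 hr1 (by simp)
          (by simp; omega) (fun k hk => hlet k (by simp [hk])) hi.tail (by rw [hlen1]; omega)
          (by omega) e13 e17 (by simpa using e18) (by rw [hlen1, e23]) e15'
      refine ⟨r2, h2, recs', (R1.trans <| Reach.jumpLt_of_lt rfl ?_ R2).mono ?_, hp2, hr2,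
        by simpa using hmem, by rw [hlen2, hlen1]; simp; omega, ?_, by simpa using f13, ?_, f23,
        f15⟩
      · rw [hr1.vars, e18]; omega
      · simp only [List.length_cons]
        rw [Nat.add_mul, Nat.one_mul]
        omega
      · rw [List.length_cons, show pos + (rem.length + 1) = pos + 1 + rem.length by ring]
        exact hi2
      · rw [f17, List.length_cons]; ring

/-- The state of a whole term is added to the list. -/
theorem PreHeap.push (hp : PreHeap n recs lst h) {w : List ℕ} (hw : w ∈ recs) :
    PreHeap n recs (w :: lst) (Function.update h (ad n recs w) (hd n recs lst)) := by
  have hlt := List.idxOf_lt_length_of_mem hw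
  have key : ∀ k d, 0 < d → d < 4 →
      Function.update h (ad n recs w) (hd n recs lst) (recAddr n k + d) = h (recAddr n k + d) := by
    intro k d h0 h4
    refine Function.update_of_ne ?_ _ _
    unfold ad recAddr
    omega
  constructor
  · intro j hj; rw [key _ _ (by decide) (by decide), hp.bit j hj]
  · rw [key _ _ (by decide) (by decide), hp.down_zero]
  · intro j hj; rw [key _ _ (by decide) (by decide), hp.down j hj]
  · intro j hj; rw [key _ _ (by decide) (by decide), hp.up j hj]
  · rw [key _ _ (by decide) (by decide), hp.up_last]
  · exact hp.head
  · exact hp.tail_mem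
  · exact hp.letters
  · intro v hv
    rcases List.mem_cons.1 hv with rfl | hv
    · exact hw
    · exact hp.lst_mem v hv
  · intro k hk; rw [key _ _ (by decide) (by decide), hp.field_false k hk]
  · intro k hk; rw [key _ _ (by decide) (by decide), hp.field_true k hk]
  · intro v hv
    by_cases hvw : v = w
    · subst hvw; simp [link]
    · rw [Function.update_of_ne (fun e => hvw (ad_inj hv e)), hp.next v hv, link, if_neg hvw]
  · intro a ha
    rw [Function.update_of_ne, hp.zero a ha]
    unfold ad recAddr at *
    omega

/-- The terms `W`, the last ones of the input, are read. -/
theorem reach_terms (hκ : 2 * E.V + 1 ≤ E.κ) {K : ℕ} (hV : recAddr n (n + 1 + K) ≤ E.V)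
    (hn : 1 ≤ n) (W : List (List ℕ)) :
    ∀ (recs lst : List (List ℕ)) (pos : ℕ) (r h : ℕ → ℕ),
    PreHeap n recs lst h → PreConsts n r → (∀ w ∈ W, w.length = n ∧ ∀ ℓ ∈ w, 1 ≤ ℓ ∧ ℓ ≤ 3) →
    InputAt E pos W.flatten → recs.length + W.length * n ≤ K → pos + W.length * n ≤ E.V →
    r 13 = recAddr n (n + 1) → r 17 = pos → r 18 = 0 →
    r 23 = recAddr n (n + 1 + recs.length) → r 15 = hd n recs lst →
    ∃ r' h' recs', Reach program E ⟨26, r, h, out⟩ (W.length * (n * (8 * K + 14) + 5) + 3)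
        ⟨55, r', h', out⟩ ∧
      PreHeap n recs' ((W.map List.reverse).reverse ++ lst) h' ∧ PreConsts n r' ∧
      r' 15 = hd n recs' ((W.map List.reverse).reverse ++ lst) := by
  induction W with
  | nil =>
    intro recs lst pos r h hp hr _ hi _ _ h13 h17 h18 h23 h15
    have hx : E.x.getD pos 0 = 0 := by simpa using hi 0
    rw [List.getD_eq_getElem?_getD] at hx
    refine ⟨_, h, recs, (Reach.input (t := 2) rfl <| Reach.jumpLt_of_le rfl ?_ <|
      Reach.jump rfl <| Reach.refl).mono (by omega), by simpa using hp, ?_, ?_⟩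
    · simp [h17, hx, hr.zero]
    · refine hr.congr fun i hi => ?_
      simp [show i ≠ 16 by omega]
    · simp [h15]
  | cons w W ih =>
    intro recs lst pos r h hp hr hW hi hK hpos h13 h17 h18 h23 h15
    obtain ⟨hwn, hwl⟩ := hW w (by simp)
    simp only [List.length_cons, Nat.add_mul, Nat.one_mul] at hK hpos
    obtain ⟨r1, h1, recs1, R1, hp1, hr1, hmem, hlen1, hi1, e13, e17, e23, e15⟩ :=
      reach_letters (out := out) hκ hV w recs [] W.flatten pos r h
      (fun e => by rw [e] at hwn; simp at hwn; omega) hp hr hp.nil_mem (by simpa using hwn) hwl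
      (by simpa using hi) (by omega) (by omega) (by rw [h13, hp.ad_nil]) h17 h18 h23 h15
    simp only [List.append_nil] at hmem e13
    have h32 : 32 ≤ ad n recs1 w.reverse := by unfold ad recAddr; omega
    obtain ⟨r2, R2, f13, f18, f15, er⟩ : ∃ r2, Reach program E ⟨50, r1, h1, out⟩ 5
        ⟨26, r2, Function.update h1 (ad n recs1 w.reverse) (hd n recs1 lst), out⟩ ∧
        r2 13 = recAddr n (n + 1) ∧ r2 18 = 0 ∧ r2 15 = hd n recs1 (w.reverse :: lst) ∧
        ∀ i, i ≠ 13 → i ≠ 15 → i ≠ 18 → r2 i = r1 i := by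
      have := Reach.store (P := program) (E := E) (pc := 50) (r := r1) (h := h1) (out := out)
        (t := 4) rfl (by omega) <| Reach.copy rfl <| Reach.const rfl <| Reach.copy rfl <|
        Reach.jump rfl <| Reach.refl
      rw [e13, e15, Nat.add_zero] at this
      refine ⟨_, this, ?_, ?_, ?_, ?_⟩
      · simp [hr1.empty]
      · simp
      · simp [hd]
      · intro i a b c; simp [a, b, c]
    obtain ⟨r3, h3, recs3, R3, hp3, hr3, g15⟩ := ih recs1 (w.reverse :: lst) (pos + w.length) r2 _
      (hp1.push hmem) (hr1.congr fun i hi => er i (by omega) (by omega) (by omega))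
      (fun v hv => hW v (by simp [hv])) hi1 (by omega) (by omega) f13
      (by rw [er 17 (by decide) (by decide) (by decide), e17]) f18
      (by rw [er 23 (by decide) (by decide) (by decide), e23]) f15
    refine ⟨r3, h3, recs3, ((R1.trans R2).trans R3).mono ?_, by simpa using hp3, hr3,
      by simpa using g15⟩
    simp only [List.length_cons, hwn]
    rw [Nat.add_mul, Nat.one_mul]
    omega

/-- The precomputation up to the end of the input. -/
theorem reach_build (hκ : 2 * E.V + 1 ≤ E.κ) (hn : 1 ≤ n) {W : List (List ℕ)}
    (hx : E.x = List.replicate n 4 ++ W.flatten)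
    (hW : ∀ w ∈ W, w.length = n ∧ ∀ ℓ ∈ w, 1 ≤ ℓ ∧ ℓ ≤ 3)
    (hV : recAddr n (n + 2 + W.length * n) + n ≤ E.V) :
    ∃ r' h' recs', Reach program E ⟨0, 0, 0, []⟩
        (W.length * (n * (8 * (1 + W.length * n) + 14) + 5) + 11 * n + 20) ⟨55, r', h', []⟩ ∧
      PreHeap n recs' (W.map List.reverse).reverse h' ∧ PreConsts n r' ∧
      r' 15 = hd n recs' (W.map List.reverse).reverse := by
  have hV' : 32 + n + 4 * (n + 2 + W.length * n) + n ≤ E.V := hV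
  have hinput : InputAt E n W.flatten := by
    intro i
    rw [hx, List.getD_append_right _ _ _ _ (by simp)]
    simp
  have hx4 : ∀ i < n, E.x.getD i 0 = 4 := by
    intro i hi
    rw [hx, List.getD_append _ _ _ _ (by simpa using hi), List.getD_replicate _ hi]
  have hxn : E.x.getD n 0 < 4 := by
    have := hinput 0
    rw [Nat.add_zero] at this
    rw [this]
    cases hf : W.flatten with
    | nil => simp
    | cons ℓ l =>
      have hm : ℓ ∈ W.flatten := by rw [hf]; simp
      obtain ⟨w, hw, hℓ⟩ := List.mem_flatten.1 hm
      have := (hW w hw).2 ℓ hℓ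
      simp; omega
  obtain ⟨r0, R0, a1, a2, a3, a4, a6, ar⟩ : ∃ r0, Reach program E ⟨0, 0, 0, []⟩ 5
      ⟨5, r0, 0, []⟩ ∧ r0 1 = 1 ∧ r0 2 = 2 ∧ r0 3 = 3 ∧ r0 4 = 4 ∧ r0 6 = 32 ∧
      ∀ i, i = 0 ∨ i = 5 → r0 i = 0 := by
    refine ⟨_, Reach.const rfl <| Reach.const rfl <| Reach.const rfl <| Reach.const rfl <|
      Reach.const rfl <| Reach.refl, ?_, ?_, ?_, ?_, ?_, ?_⟩
    · simp
    · simp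
    · simp
    · simp
    · simp
    · rintro i (rfl | rfl) <;> simp
  obtain ⟨r1, R1, b5, br⟩ := reach_count (h := 0) (out := []) hκ (by omega) hx4 hxn n 0 r0
    (by omega) (ar 5 (by simp)) a1 a4
  obtain ⟨r2, R2, c7, c8, c11, cr⟩ : ∃ r2, Reach program E ⟨9, r1, 0, []⟩ 3 ⟨12, r2, 0, []⟩ ∧
      r2 7 = 32 + n ∧ r2 8 = recAddr n 0 ∧ r2 11 = 32 + 0 ∧
      ∀ i, i ≠ 7 → i ≠ 8 → i ≠ 11 → r2 i = r1 i := by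
    have e6 : r1 6 = 32 := by rw [br 6 (by decide) (by decide), a6]
    refine ⟨_, Reach.add rfl hκ ?_ <| Reach.copy rfl <| Reach.copy rfl <| Reach.refl,
      ?_, ?_, ?_, ?_⟩
    · rw [e6, b5]; omega
    · simp [e6, b5]
    · simp [e6, b5, recAddr]
    · simp [e6]
    · intro i a b c; simp [a, b, c]
  have d1 : r2 1 = 1 := by
    rw [cr 1 (by decide) (by decide) (by decide), br 1 (by decide) (by decide), a1]
  have d4 : r2 4 = 4 := by
    rw [cr 4 (by decide) (by decide) (by decide), br 4 (by decide) (by decide), a4]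
  obtain ⟨r3, h3, R3, hl, e8, er⟩ := reach_levels (out := []) hκ
    (by unfold recAddr at *; omega) (n - 1) 0 r2 0 (by omega)
    ⟨fun i hi => absurd hi (by omega), rfl, fun i hi => absurd hi (by omega),
      fun i hi => absurd hi (by omega), fun _ _ => rfl⟩ c8 c11 c7 d4 d1
  have f1 : r3 1 = 1 := by rw [er 1 (by decide) (by decide) (by decide), d1]
  have f4 : r3 4 = 4 := by rw [er 4 (by decide) (by decide) (by decide), d4]
  have f7 : r3 7 = 32 + n := by rw [er 7 (by decide) (by decide) (by decide), c7]
  have f5 : r3 5 = n := by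
    rw [er 5 (by decide) (by decide) (by decide), cr 5 (by decide) (by decide) (by decide), b5]
  have f2 : r3 2 = 2 := by
    rw [er 2 (by decide) (by decide) (by decide), cr 2 (by decide) (by decide) (by decide),
      br 2 (by decide) (by decide), a2]
  have f3 : r3 3 = 3 := by
    rw [er 3 (by decide) (by decide) (by decide), cr 3 (by decide) (by decide) (by decide),
      br 3 (by decide) (by decide), a3]
  have f6 : r3 6 = 32 := by
    rw [er 6 (by decide) (by decide) (by decide), cr 6 (by decide) (by decide) (by decide),
      br 6 (by decide) (by decide), a6]
  have f0 : r3 0 = 0 := by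
    rw [er 0 (by decide) (by decide) (by decide), cr 0 (by decide) (by decide) (by decide),
      br 0 (by decide) (by decide), ar 0 (by simp)]
  have g1 : recAddr n n + 4 = recAddr n (n + 1) := by unfold recAddr; ring
  have g2 : recAddr n (n + 1) + 4 = recAddr n (n + 1 + 1) := by unfold recAddr; ring
  have g3 : recAddr n (n + 1 + 1) ≤ E.V := by unfold recAddr; omega
  obtain ⟨r4, R4, hr4, k13, k17, k18, k23, k15⟩ : ∃ r4, Reach program E ⟨19, r3, h3, []⟩ 7
      ⟨26, r4, h3, []⟩ ∧ PreConsts n r4 ∧ r4 13 = recAddr n (n + 1) ∧ r4 17 = n ∧ r4 18 = 0 ∧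
      r4 23 = recAddr n (n + 1 + 1) ∧ r4 15 = 1 := by
    refine ⟨_, Reach.sub rfl hκ <| Reach.add rfl hκ ?_ <| Reach.copy rfl <|
      Reach.add rfl hκ ?_ <| Reach.copy rfl <| Reach.const rfl <| Reach.const rfl <| Reach.refl,
      ⟨⟨?_, ?_, ?_, ?_⟩, ?_, ?_, ?_, ?_, ?_, ?_⟩, ?_, ?_, ?_, ?_, ?_⟩
    · simp [e8, f4, g1]; omega
    · simp [e8, f4, g1, g2, g3]
    · simp [f0]
    · simp [f1]
    · simp [f6]
    · simp [f7, f1]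
    · simp [f2]
    · simp [f3]
    · simp [f4]
    · simp [f5]
    · simp [e8]
    · simp [e8, f4, g1]
    · simp [e8, f4, g1]
    · simp [f5]
    · simp
    · simp [e8, f4, g1, g2]
    · simp
  -- so far the only record of a state is that of the empty word, with no restrictions
  have hp : PreHeap n [[]] [] h3 := by
    have hz : ∀ a, recAddr n (n + 1) ≤ a → h3 a = 0 := by
      intro a ha
      refine hl.zero a ?_
      unfold recAddr at *
      omega
    refine ⟨hl.bit, hl.down_zero, hl.down, hl.up, hl.zero _ le_rfl, rfl, by simp, by simp,
      by simp, ?_, ?_, ?_, ?_⟩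
    · intro k hk
      obtain rfl : k = 0 := by simpa using hk
      exact hz _ (by simp)
    · intro k hk
      obtain rfl : k = 0 := by simpa using hk
      exact hz _ (by simp)
    · intro u hu
      obtain rfl : u = [] := by simpa using hu
      exact hz _ (by simp [ad])
    · intro a ha
      refine hz a ?_
      unfold recAddr at *
      simp at ha
      omega
  obtain ⟨r5, h5, recs', R5, hp5, hr5, e15⟩ := reach_terms (out := []) (K := 1 + W.length * n)
    hκ (by unfold recAddr; omega) hn W [[]] [] n r4 h3 hp hr4 hW hinput (by simp)
    (by omega) k13 k17 k18 (by simpa using k23) (by simp [k15, hd])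
  refine ⟨r5, h5, recs', (((((R0.trans R1).trans R2).trans R3).trans R4).trans R5).mono ?_,
    by simpa using hp5, hr5, by simpa using e15⟩
  omega

/-- After the precomputation the heap is ready for the search. -/
theorem PreHeap.static (hp : PreHeap n recs lst h) : Static n recs h := by
  have key : ∀ w ∈ recs, h (ad n recs w + 1) = fld n recs false w ∧
      h (ad n recs w + 2) = fld n recs true w := by
    intro w hw
    have hlt := List.idxOf_lt_length_of_mem hw
    have h1 := hp.field_false _ hlt
    have h2 := hp.field_true _ hlt
    rw [List.getElem_idxOf hlt] at h1 h2
    exact ⟨h1, h2⟩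
  exact ⟨hp.bit, hp.down_zero, hp.down, hp.up, hp.up_last, hp.tail_mem,
    fun ℓ u hu => (key _ hu).1, fun ℓ u hu => (key _ hu).2⟩

theorem PreHeap.dyn (hp : PreHeap n recs lst h) (hlen : ∀ w ∈ lst, w.length = n) :
    Dyn n recs h (Function.update (fun _ => []) n lst) := by
  intro u hu
  rw [hp.next u hu]
  by_cases hun : u.length = n
  · rw [hun, Function.update_self]
  · rw [Function.update_of_ne hun, link_of_not_mem (fun hm => hun (hlen u hm))]
    rfl

end

/-! ### Terms as words -/

theorem allows_letter {n : ℕ} (T : Term n) (i : Fin n) (b : Bool) :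
    allows (T.letter i) b = true ↔ (i, !b) ∉ T.lits := by
  unfold Term.letter
  by_cases h1 : (i, false) ∈ T.lits
  · have h2 : (i, true) ∉ T.lits := fun h2 => by
      have := T.consistent _ h1 _ h2 rfl
      simp at this
    cases b <;> simp [allows, h1, h2]
  · by_cases h2 : (i, true) ∈ T.lits <;> cases b <;> simp [allows, h1, h2]

theorem letter_bounds {n : ℕ} (T : Term n) (i : Fin n) : 1 ≤ T.letter i ∧ T.letter i ≤ 3 := by
  unfold Term.letter
  split_ifs <;> simp

theorem ofFn_letter_injective {n : ℕ} :
    Function.Injective (fun T : Term n => List.ofFn T.letter) := by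
  intro T T' h
  have h' : T.letter = T'.letter := List.ofFn_injective h
  ext ⟨i, b⟩
  have h1 := allows_letter T i (!b)
  have h2 := allows_letter T' i (!b)
  rw [h', h2, Bool.not_not] at h1
  exact not_iff_not.1 h1.symm

theorem satisfiedBy_iff {n : ℕ} (T : Term n) (a : Fin n → Bool) :
    T.SatisfiedBy a ↔ ∀ i, allows (T.letter i) (a i) = true := by
  simp only [allows_letter]
  constructor
  · intro h i hi
    have := h _ hi
    simp at this
  · rintro h ⟨i, b⟩ hi
    have := h i
    cases b <;> cases hai : a i <;> simp_all

theorem forall₂_ofFn {n : ℕ} {α β : Type*} {R : α → β → Prop} (f : Fin n → α) (g : Fin n → β) :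
    List.Forall₂ R (List.ofFn f) (List.ofFn g) ↔ ∀ i, R (f i) (g i) := by
  rw [List.forall₂_iff_get]
  constructor
  · rintro ⟨-, h⟩ i
    simpa using h i (by simp) (by simp)
  · intro h
    refine ⟨by simp, fun i h1 h2 => ?_⟩
    simpa using h ⟨i, by simpa using h1⟩

theorem isWords_reverse {n : ℕ} (L : List (Term n)) :
    IsWords n ((L.map (fun T => List.ofFn T.letter)).map List.reverse).reverse := by
  intro w hw
  simp only [List.map_map, List.mem_reverse, List.mem_map, Function.comp_apply] at hw
  obtain ⟨T, -, rfl⟩ := hw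
  refine ⟨by simp, fun ℓ hℓ => ?_⟩
  simp only [List.mem_reverse, List.mem_ofFn] at hℓ
  obtain ⟨i, rfl⟩ := hℓ
  exact letter_bounds T i

/-- The search outputs the models of the DNF. -/
theorem mem_map_enum_iff {n : ℕ} {D : DNF n} {L : List (Term n)} (hL : ∀ T, T ∈ L ↔ T ∈ D)
    (hne : L ≠ []) (y : List ℕ) :
    y ∈ (enum n ((L.map (fun T => List.ofFn T.letter)).map List.reverse).reverse).map
      (fun v => v.reverse.map Bool.toNat) ↔ ∃ a, D.IsModel a ∧ y = encodeAssignment a := by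
  have key : ∀ a : Fin n → Bool, (List.ofFn a).reverse ∈
      enum n ((L.map (fun T => List.ofFn T.letter)).map List.reverse).reverse ↔
      D.IsModel a := by
    intro a
    rw [mem_enum (by simpa using hne) (isWords_reverse L)]
    simp only [List.map_map, List.mem_reverse, List.mem_map, Function.comp_apply,
      exists_exists_and_eq_and, List.forall₂_reverse_iff, forall₂_ofFn, DNF.IsModel,
      satisfiedBy_iff, hL]
  have henc : ∀ a : Fin n → Bool, encodeAssignment a = (List.ofFn a).map Bool.toNat := by
    intro a
    rw [List.map_ofFn]
    rfl
  rw [List.mem_map]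
  constructor
  · rintro ⟨v, hv, rfl⟩
    have hlen : v.reverse.length = n := by simpa using length_eq_of_mem_enum hv
    obtain ⟨a, ha⟩ : ∃ a : Fin n → Bool, List.ofFn a = v.reverse := by
      subst hlen
      exact ⟨_, List.ofFn_get _⟩
    refine ⟨a, (key a).1 ?_, ?_⟩
    · rw [ha, List.reverse_reverse]; exact hv
    · rw [henc, ha]
  · rintro ⟨a, ha, rfl⟩
    exact ⟨_, (key a).2 ha, by rw [henc, List.reverse_reverse]⟩

/-! ### The bounds for the whole run -/

/-- The facts about a run that consists of a precomputation and a search. -/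
theorem Reach.conclude {P : Program} {E E' : Env} (hx : E.x = E'.x) (hV : E.V = E'.V)
    {s s' : St} {t t' : ℕ} (R : Reach P E ⟨0, 0, 0, []⟩ t s) (R' : Reach P E' s t' s')
    (hout : s.out = []) (hpc : P.length ≤ s'.pc) :
    ∃ k₀ k, k₀ ≤ k ∧ (run P E.x k₀).out = [] ∧ (run P E.x k₀).time ≤ t * E.κ ∧
      (run P E.x k).Halted P ∧ (run P E.x k).time ≤ (run P E.x k₀).time + t' * E'.κ ∧
      (run P E.x k).out = s'.out ∧ ∀ i, (run P E.x i).space ≤ (E.V + 40) * E.V := by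
  have hinit : St.Matches ⟨0, 0, 0, []⟩ Config.init := by
    refine ⟨rfl, ?_, rfl⟩
    funext a
    simp [Config.init, mem]
  have hg : Good E.V Config.init.reg := by
    intro a
    simp [Config.init]
  obtain ⟨k₀, h1, h2, h3⟩ := R _ hinit hg
  obtain ⟨k, h1', h2', h3'⟩ := R' _ h1 (hV ▸ h3 k₀ le_rfl)
  rw [← hx, ← Function.iterate_add_apply] at h1' h2'
  have hhalt : (run P E.x (k + k₀)).Halted P := by
    unfold Config.Halted run
    rw [h1'.1]; exact hpc
  refine ⟨k₀, k + k₀, by omega, h1.2.2.trans hout, by simpa [run, Config.init] using h2, hhalt, h2',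
    h1'.2.2, fun i => ?_⟩
  refine Good.space_le ?_
  have hle : ∀ i ≤ k + k₀, Good E.V (run P E.x i).reg := by
    intro i hi
    rcases le_total i k₀ with hik | hik
    · exact h3 i hik
    · obtain ⟨j, rfl⟩ := Nat.exists_eq_add_of_le' hik
      have := h3' j (by omega)
      rw [← hx, ← hV, ← Function.iterate_add_apply] at this
      exact this
  rcases le_total i (k + k₀) with hik | hik
  · exact hle i hik
  -- a halted configuration does not change any more
  · obtain ⟨j, rfl⟩ := Nat.exists_eq_add_of_le' hik
    have hfix : RAM.step P E.x (run P E.x (k + k₀)) = run P E.x (k + k₀) := by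
      unfold RAM.step
      rw [List.getElem?_eq_none hhalt]
    have : run P E.x (j + (k + k₀)) = run P E.x (k + k₀) := by
      unfold run at *
      rw [Function.iterate_add_apply]
      exact Function.iterate_fixed hfix j
    rw [this]
    exact hle _ le_rfl

theorem getD_encodeTerms_le {n : ℕ} (L : List (Term n)) (i : ℕ) :
    (encodeTerms L).getD i 0 ≤ 4 := by
  by_cases hi : i < (encodeTerms L).length
  · rw [List.getD_eq_getElem _ _ hi]
    have hm := List.getElem_mem hi
    generalize (encodeTerms L)[i] = y at hm
    simp only [encodeTerms, List.mem_append, List.mem_replicate, List.mem_flatMap,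
      List.mem_ofFn] at hm
    rcases hm with ⟨-, rfl⟩ | ⟨T, -, i, rfl⟩
    · exact le_rfl
    · have := letter_bounds T i
      omega
  · rw [List.getD_eq_default _ _ (by omega)]
    omega

theorem length_encodeTerms {n : ℕ} (L : List (Term n)) :
    (encodeTerms L).length = n + L.length * n := by
  simp [encodeTerms, List.length_flatMap]

/-- The environment for the input of a list of terms, if the unit of time is `κ + 1`. -/
def termsEnv {n : ℕ} (L : List (Term n)) (κ : ℕ) : Env where
  x := encodeTerms L
  V := 9 * (encodeTerms L).length + 100
  κ := κ + 1
  x_le := fun i => (getD_encodeTerms_le L i).trans (by omega)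
  V_ge := by omega
  κ_pos := by omega

end DNFEnum

open DNFEnum RAM in
theorem mainTheorem2 :
    ∃ (P : RAM.Program) (C : ℝ) (p q : Polynomial ℕ),
      ∀ (n : ℕ), 1 ≤ n →
      ∀ (D : DNF n) (L : List (Term n)), L.Nodup → (∀ T, T ∈ L ↔ T ∈ D) →
        RAM.Enumerates P (encodeTerms L) {y | ∃ a, D.IsModel a ∧ y = encodeAssignment a} ∧
        RAM.HasAverageDelay P (encodeTerms L) (p.eval (encodeTerms L).length)
          (C * (n * (D.card : ℝ) ^ (1 - Real.logb 3 2))) ∧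
        RAM.UsesSpace P (encodeTerms L) (q.eval (encodeTerms L).length) := by
  refine ⟨program, 208,
    -- the number of instructions times the time of an instruction on numbers below `9 * N + 100`
    (8 * Polynomial.X ^ 2 + 38 * Polynomial.X + 22) * (18 * Polynomial.X + 201),
    (9 * Polynomial.X + 140) * (9 * Polynomial.X + 100), ?_⟩
  intro n hn D L hnd hL
  have hcard : D.card = L.length := by
    classical
    rw [← List.toFinset_card_of_nodup hnd]
    congr 1
    ext T
    rw [List.mem_toFinset, hL]
  set N := (encodeTerms L).length with hN
  have hNL : N = n + L.length * n := length_encodeTerms L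
  set E := termsEnv L (2 * (termsEnv L 0).V) with hE
  have hEV : E.V = 9 * N + 100 := rfl
  have hEκ : E.κ = 18 * N + 201 := by
    change 2 * (9 * N + 100) + 1 = _
    ring
  -- the words of the terms, in the order in which they are linked
  set W := L.map (fun T => List.ofFn T.letter) with hW
  have hWlen : W.length = L.length := by simp [hW]
  set A := (W.map List.reverse).reverse with hA
  have hAlen : A.length = L.length := by simp [hA, hW]
  have hAw : IsWords n A := isWords_reverse L
  have hAnd : A.Nodup := by
    rw [hA, List.nodup_reverse]
    exact (hnd.map ofFn_letter_injective).map List.reverse_injective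
  obtain ⟨r, h, recs, R, hp, hr, h15⟩ := reach_build (E := E) (W := W) (n := n)
    (by rw [hEκ, hEV]; omega) hn
    (by change encodeTerms L = _; simp [encodeTerms, hW, List.flatMap])
    (by
      intro w hw
      obtain ⟨T, -, rfl⟩ := List.mem_map.1 hw
      refine ⟨by simp, fun ℓ hℓ => ?_⟩
      obtain ⟨i, rfl⟩ := List.mem_ofFn.1 hℓ
      exact letter_bounds T i)
    (by rw [hEV, hWlen]; unfold recAddr; omega)
  rw [← hA] at hp h15
  -- each letter of the input takes a search among at most `N + 1` records, of at most `8`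
  -- instructions each
  have hsteps : W.length * (n * (8 * (1 + W.length * n) + 14) + 5) + 11 * n + 20 + 2 ≤
      8 * N ^ 2 + 38 * N + 22 := by
    rw [hWlen, hNL]
    nlinarith [Nat.zero_le (L.length * n), Nat.mul_le_mul_left L.length hn,
      Nat.zero_le (n * n), Nat.zero_le (n * (L.length * n))]
  -- it remains to describe the two phases of the run
  suffices hmain : ∃ s s' t', Reach program E ⟨0, 0, 0, []⟩ (8 * N ^ 2 + 38 * N + 22) s ∧
      Reach program (termsEnv L 0) s t' s' ∧ s.out = [] ∧ program.length ≤ s'.pc ∧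
      s'.out.Nodup ∧ (∀ y, y ∈ s'.out ↔ ∃ a, D.IsModel a ∧ y = encodeAssignment a) ∧
      (t' : ℝ) ≤ 208 * (n * (D.card : ℝ) ^ (1 - Real.logb 3 2)) * s'.out.length by
    obtain ⟨s, s', t', R1, R2, hout, hpc, hsnd, hsm, ht'⟩ := hmain
    obtain ⟨k₀, k, hk, g1, g2, g3, g4, g5, g6⟩ := Reach.conclude
      (E := E) (E' := termsEnv L 0) rfl rfl R1 R2 hout hpc
    refine ⟨⟨k, g3, ?_, ?_⟩, ⟨k₀, k, hk, g1, ?_, g3, ?_⟩, fun i => ?_⟩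
    · rw [show (run program (encodeTerms L) k).out = s'.out from g5]
      exact hsnd
    · intro y
      rw [show (run program (encodeTerms L) k).out = s'.out from g5]
      exact hsm y
    · refine g2.trans_eq ?_
      rw [hEκ]
      simp
    · rw [show (run program (encodeTerms L) k).out = s'.out from g5]
      refine le_trans ?_ ht'
      have g4' : (run program (encodeTerms L) k).time ≤
          (run program (encodeTerms L) k₀).time + t' * 1 := g4
      have : ((run program (encodeTerms L) k).time : ℝ) ≤
          (run program (encodeTerms L) k₀).time + t' := by
        exact_mod_cast g4'.trans_eq (by ring)
      linarith
    · refine (g6 i).trans_eq ?_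
      rw [hEV]
      simp
  by_cases hne : L = []
  · -- a DNF without terms: the program halts after the precomputation
    have hAe : A = [] := by simp [hA, hW, hne]
    refine ⟨_, _, 0, (R.trans (t' := 2) <| Reach.jumpLt_of_le rfl ?_ <| Reach.jump rfl <|
      Reach.refl).mono hsteps, Reach.refl, rfl, le_rfl, List.nodup_nil, ?_, by simp⟩
    · rw [h15, hAe, hr.one, hd]
    · intro y
      simp [DNF.IsModel, ← hL, hne]
  · have hAne : A ≠ [] := by simpa [hA, hW] using hne
    have hlen : ∀ w ∈ A, w.length = n := fun w hw => (hAw w hw).1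
    set lists : ℕ → List (List ℕ) := Function.update (fun _ => []) n A with hlists
    have hln : lists n = A := Function.update_self ..
    have h32 : 32 ≤ recAddr n n := by unfold recAddr; omega
    obtain ⟨r', h', R'⟩ := reach_search (E := termsEnv L 0) (out := []) (lists := lists)
      (h := Function.update h (recAddr n n) (hd n recs A)) (r := r)
      (hp.static.update (Or.inr ⟨n, rfl⟩))
      ((hp.dyn hlen).update_low (by unfold recAddr; omega)) hr.toConsts hr.top
      (fun i hi => Function.update_of_ne (by omega) _ _) (by rwa [hln])
      (by rw [hln]; exact ⟨hAnd, hp.lst_mem, hlen⟩) (by rw [hln]; exact Function.update_self ..)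
    rw [hln, List.nil_append] at R'
    have R1 : Reach program E ⟨55, r, h, []⟩ 2
        ⟨58, r, Function.update h (recAddr n n) (hd n recs A), []⟩ := by
      have := Reach.jumpLt_of_lt (P := program) (E := E) (pc := 55) (r := r) (h := h) (out := [])
        (t := 1) rfl (by rw [h15, hr.one]; exact one_lt_hd hAne) <|
        Reach.store rfl (by rw [hr.top]; omega) Reach.refl
      rw [hr.top, h15] at this
      exact this
    refine ⟨_, _, _, (R.trans R1).mono hsteps, R', rfl, le_rfl, ?_, mem_map_enum_iff hL hne, ?_⟩
    · refine (nodup_enum n A).map ?_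
      intro v v' hv
      have hinj : Function.Injective Bool.toNat := by decide
      exact List.reverse_injective (List.map_injective_iff.2 hinj hv)
    · have hM : (A.length : ℝ) ≤ (D.card : ℝ) := by rw [hAlen, hcard]
      have c1 := cost_le hAw hAnd hAne hM
      have c2 := length_le_rpow_mul_length_enum hAw hAnd hAne hM
      have c3 : (1 : ℝ) ≤ A.length := by exact_mod_cast List.length_pos_iff.2 hAne
      have c4 : (1 : ℝ) ≤ n := by exact_mod_cast hn
      simp only [List.length_map]
      rw [Nat.cast_add, Nat.cast_add, Nat.cast_mul, Nat.cast_ofNat]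
      set M := (D.card : ℝ) ^ (1 - Real.logb 3 2)
      set s := ((enum n A).length : ℝ)
      have c5 : M * s ≤ n * (M * s) := le_mul_of_one_le_left (by linarith) c4
      have c6 : 100 * ((n : ℝ) + 1) * M * s = 100 * (n * (M * s)) + 100 * (M * s) := by ring
      have c7 : 208 * (n * M) * s = 208 * (n * (M * s)) := by ring
      rw [c6] at c1
      rw [c7]
      linarith
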